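/- Let $\mathit{Atm}$ be a countable set of atomic propositions (with a fixed numbering by natural numbers) and let $\mathit{Agt}=\{1,\dots,m\}$ be a finite set of agents. The formulas of the compass logic of space $\mathcal L_{\mathsf{CL}\text{-}\mathsf{S}^*}(\mathit{Atm},\mathit{Agt})$ are given by $$\varphi ::= p \mid h_i \mid \neg\varphi \mid \varphi\wedge\psi \mid [\alpha]\varphi ,\qquad p\in \mathit{Atm},\ i\in\mathit{Agt},\ \alpha\in\{\Uparrow,\Downarrow,\Rightarrow,\Leftarrow,\Uparrow^*,\Downarrow^*,\Rightarrow^*,\Leftarrow^*\}.$$ A spatial model $M=(P,V)$ consists of maps $P:\mathit{Agt}\to\mathbb Z^2$ and $V:\mathbb Z^2\to 2^{\mathit{Atm}}$. Truth at $z\in\mathbb Z^2$ is defined by: $M,z\models p$ iff $p\in V(z)$; $M,z\models h_i$ iff $P(i)=z$; the Boolean clauses are as usual; and $M,z\models[\alpha]\varphi$ iff $M,w\models\varphi$ for all $w$ with $z\,R_\alpha\,w$, where $R_\Uparrow,R_\Downarrow,R_\Rightarrow,R_\Leftarrow$ relate $(x,y)$ to $(x,y+1)$, $(x,y-1)$,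 $(x+1,y)$, $(x-1,y)$ respectively, and $R_{\alpha^*}$ is the reflexive transitive closure of $R_\alpha$. For $n\in\mathbb N$, write $|(x,y)|\le n$ if $|x|\le n$ and $|y|\le n$; $M$ is $n$-bounded if $|P(i)|\le n$ for every $i\in\mathit{Agt}$, and $V(z)=\emptyset$ for every $z\in\mathbb Z^2$ with $|z|\not\le n$. The model-checking problem for $\mathcal L_{\mathsf{CL}\text{-}\mathsf{S}^*}(\mathit{Atm},\mathit{Agt})$ is the following: given a formula $\varphi$, a nonnegative integer $n$, an $n$-bounded spatial model $M$ in which every $V(z)$ is finite, and a position $(x,y)\in\mathbb Z^2$, is it the case that $M,(x,y)\models\varphi$? Instances are written as words over a finite alphabet: the formula in prefix notation, the integers $n,x,y$ and the names of atoms and agents in binary, and the model as the $(2n+1)\times(2n+1)$ grid of positions $z$ with $|z|\le n$, where each cell lists the agents located there and the atomic propositions true there. **Theorem.** For all such $\mathit{Atm}$ and $\mathit{Agt}$, the model-checking problem for $\mathcal L_{\mathsf{CL}\text{-}\mathsf{S}^*}(\mathit{Atm},\mathit{Agt})$ is decidable in deterministic polynomial time: there are a deterministic (multi-stack) Turing machine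 and a polynomial $q$ such that on every instance, written as a word of length $\ell$, the machine halts after at most $q(\ell)$ steps with the correct answer. -/

import Mathlib

namespace CompassLogic

/-- The four compass directions: the atomic programs `⇑`, `⇓`, `⇒`, `⇐`. -/
inductive Dir where
  | up | down | right | left
  deriving DecidableEq

instance : Fintype Dir where
  elems := {.up, .down, .right, .left}
  complete d := by cases d <;> simp

/-- The eight programs `⇑, ⇓, ⇒, ⇐, ⇑*, ⇓*, ⇒*, ⇐*` of compass logic. -/
inductive Prog where
  | step (d : Dir)
  | star (d : Dir)
  deriving DecidableEq, Fintype

/-- Formulas of `CL-S*` over the atomic propositions `Atm` and the agents `Agt`. -/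
inductive Formula (Atm Agt : Type) where
  | atom (p : Atm)
  | here (i : Agt)
  | neg (φ : Formula Atm Agt)
  | and (φ ψ : Formula Atm Agt)
  | box (α : Prog) (φ : Formula Atm Agt)

/-- A spatial model: a position for every agent, and the set of facts true at each position. -/
structure SpatialModel (Atm Agt : Type) where
  P : Agt → ℤ × ℤ
  V : ℤ × ℤ → Set Atm

/-- One step in direction `d`. -/
def Dir.rel : Dir → ℤ × ℤ → ℤ × ℤ → Prop
  | .up, z, w => w.1 = z.1 ∧ w.2 = z.2 + 1
  | .down, z, w => w.1 = z.1 ∧ w.2 = z.2 - 1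
  | .right, z, w => w.1 = z.1 + 1 ∧ w.2 = z.2
  | .left, z, w => w.1 = z.1 - 1 ∧ w.2 = z.2

/-- The accessibility relation `R_α`. -/
def Prog.rel : Prog → ℤ × ℤ → ℤ × ℤ → Prop
  | .step d => d.rel
  | .star d => Relation.ReflTransGen d.rel

/-- `Sat M φ z` is the truth relation `M, z ⊨ φ`. -/
def Sat {Atm Agt : Type} (M : SpatialModel Atm Agt) : Formula Atm Agt → ℤ × ℤ → Prop
  | .atom p, z => p ∈ M.V z
  | .here i, z => M.P i = z
  | .neg φ, z => ¬ Sat M φ z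
  | .and φ ψ, z => Sat M φ z ∧ Sat M ψ z
  | .box α φ, z => ∀ w, α.rel z w → Sat M φ w

/-- `|(x, y)| ≤ n`. -/
def InBox (n : ℕ) (z : ℤ × ℤ) : Prop := |z.1| ≤ n ∧ |z.2| ≤ n

/-- `n`-bounded spatial models. -/
def SpatialModel.Bounded {Atm Agt : Type} (M : SpatialModel Atm Agt) (n : ℕ) : Prop :=
  (∀ i, InBox n (M.P i)) ∧ ∀ z, ¬ InBox n z → M.V z = ∅

/-- An instance of the model-checking problem for the agents `1, …, m`. Only finitely many atomic
propositions hold at each position, so that the model is a finite object. -/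
structure Instance (Atm : Type) (m : ℕ) where
  formula : Formula Atm (Fin m)
  n : ℕ
  model : SpatialModel Atm (Fin m)
  bounded : model.Bounded n
  finite : ∀ z, (model.V z).Finite
  position : ℤ × ℤ

/-- The finite alphabet in which instances are written. -/
inductive Sym where
  | bit (b : Bool)
  | minus
  | close
  | atom
  | here
  | neg
  | and
  | box (α : Prog)
  | cell
  | row
  | sep
  deriving DecidableEq, Fintype

/-- A natural number in binary, least significant digit first. -/
def natWord (k : ℕ) : List Sym := k.bits.map Sym.bit ++ [Sym.close]

/-- An integer in binary, with a sign. -/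
def intWord (z : ℤ) : List Sym := (if z < 0 then [Sym.minus] else []) ++ natWord z.natAbs

/-- The name of the atomic proposition number `k`. -/
def atomWord (k : ℕ) : List Sym := Sym.atom :: natWord k

/-- The name of the nominal `here i`. -/
def hereWord {m : ℕ} (i : Fin m) : List Sym := Sym.here :: natWord i

/-- A formula in prefix (Polish) notation. -/
def formulaWord {Atm : Type} [Encodable Atm] {m : ℕ} : Formula Atm (Fin m) → List Sym
  | .atom p => atomWord (Encodable.encode p)
  | .here i => hereWord i
  | .neg φ => Sym.neg :: formulaWord φ
  | .and φ ψ => Sym.and :: (formulaWord φ ++ formulaWord ψ)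
  | .box α φ => Sym.box α :: formulaWord φ

namespace Instance

variable {Atm : Type} [Encodable Atm] {m : ℕ}

/-- The content of the cell `z`: the names of the agents that are at `z`, then the names of the
atomic propositions that are true at `z`, both in increasing order. -/
noncomputable def cellWord (I : Instance Atm m) (z : ℤ × ℤ) : List Sym :=
  Sym.cell ::
    (((List.finRange m).filter (fun i => I.model.P i = z)).flatMap hereWord ++
      (((I.finite z).image Encodable.encode).toFinset.sort (· ≤ ·)).flatMap atomWord)

/-- The list `-n, …, n`. -/
def coords (n : ℕ) : List ℤ := (List.range (2 * n + 1)).map (fun j => (j : ℤ) - n)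

/-- The model, written cell by cell as a grid with rows `y = -n, …, n` and columns
`x = -n, …, n`. -/
noncomputable def gridWord (I : Instance Atm m) : List Sym :=
  (coords I.n).flatMap fun y =>
    Sym.row :: (coords I.n).flatMap fun x => I.cellWord (x, y)

/-- The word that encodes an instance: the formula, the bound `n`, the model, the position. -/
noncomputable def encode (I : Instance Atm m) : List Sym :=
  formulaWord I.formula ++ Sym.sep :: natWord I.n ++ I.gridWord ++
    Sym.sep :: (intWord I.position.1 ++ intWord I.position.2)

open Classical in
/-- The answer to the model-checking problem. -/
noncomputable def answer (I : Instance Atm m) : Bool :=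
  decide (Sat I.model I.formula I.position)

end Instance

end CompassLogic

namespace CompassLogic

/-! The mathematical core is a stability statement: in a model bounded by `n`, the truth value of φ
no longer changes along a compass direction once the coordinate in that direction is at least `n`
plus the length of φ (`stableFrom_sat`). So the infinite plane can be replaced by the square of
radius `N = n + |φ|`. At its border a missing neighbour is replaced by the cell itself for `[d]`,
and by "true" for `[d*]` (`combine_sat`).

On this finite square, evaluation is bottom-up. Every cell carries a stack of truth values, and the
prefix word of the formula is consumed from its end, so that it acts as a postfix program: a name
pushes a value, negation and boxes replace the top value, and conjunction merges two values
(`steps_eval`). Since `[d*]φ` is equivalent to `φ ∧ [d][d*]φ`, both kinds of box are computed by one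
sweep over the grid against the direction `d`, which hands each cell the value saved at its
neighbour (`ex_dirPass`).

The queried position is given in binary and may be exponentially far away. The grid of truth values
is translated towards it by repeated `[d]` sweeps until the wanted value sits at the origin. By
stability, more than `2N+1` translations in one direction change nothing inside the square, so the
iteration is cut off there (`ex_shift`). The answer is then the middle cell (`ex_middle`).

Since the grid is written out, `n` is at most the length of the instance even though it is also
given in binary. All sizes are therefore linear in the instance: a sweep costs cubic time, and
linearly many sweeps give a quartic bound (`ex_modelCheck`).

For the passage to Turing machines, the algorithm is written in a small language of stack programs
with a timed big-step semantics. It compiles to the machine model without time overhead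
(`Runs.sound`), except for one final step that outputs the answer (`computable`). -/

open Turing

/-! ### Stack programs and their compilation to Turing machines -/

/-- Structured programs for a machine with stacks `κ` over the alphabet `A`, returning a value. -/
inductive Cmd (κ A : Type) : Type → Type 1
  | ret {α : Type} (a : α) : Cmd κ A α
  | push (k : κ) (s : A) : Cmd κ A Unit
  | pop (k : κ) : Cmd κ A (Option A)
  | bind {α β : Type} [Finite α] (c : Cmd κ A α) (f : α → Cmd κ A β) : Cmd κ A β
  | loop {α β : Type} [Finite α] (f : α → Cmd κ A (α ⊕ β)) (a : α) : Cmd κ A β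

namespace Cmd

variable {κ A : Type}

/-- The control points of a program. -/
def Lab : {α : Type} → Cmd κ A α → Type
  | _, ret _ => Unit
  | _, push _ _ => Unit
  | _, pop _ => Unit
  | _, bind c f => c.Lab ⊕ (Σ a, (f a).Lab)
  | _, loop f _ => Σ a, (f a).Lab

/-- The control point at which a program starts. -/
def entry : {α : Type} → (c : Cmd κ A α) → c.Lab
  | _, ret _ => ()
  | _, push _ _ => ()
  | _, pop _ => ()
  | _, bind c _ => Sum.inl c.entry
  | _, loop f a => ⟨a, (f a).entry⟩

/-- Intermediate results and loop states are remembered in the control point, so there is one copy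
of the continuation for each of them. This is why `bind` and `loop` demand a finite type. -/
theorem finite_lab : {α : Type} → (c : Cmd κ A α) → Finite c.Lab
  | _, ret _ => inferInstanceAs (Finite Unit)
  | _, push _ _ => inferInstanceAs (Finite Unit)
  | _, pop _ => inferInstanceAs (Finite Unit)
  | _, bind c f => by
    have := c.finite_lab
    have := fun a => (f a).finite_lab
    exact inferInstanceAs (Finite (c.Lab ⊕ (Σ a, (f a).Lab)))
  | _, loop f _ => by
    have := fun a => (f a).finite_lab
    exact inferInstanceAs (Finite (Σ a, (f a).Lab))

/-- The alphabets of the compiled machine: an output stack `none`, and the stacks of the program. -/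
@[reducible]
def Alph (κ A : Type) : Option κ → Type
  | none => Bool
  | some _ => A

/-- The machine code of a program whose control points are embedded in `Λ` and which continues,
with the result `a`, at `exit a`. -/
def code {Λ : Type} : {α : Type} → (c : Cmd κ A α) → (c.Lab → Λ) → (α → Λ) → c.Lab →
    TM2.Stmt (Alph κ A) Λ (Option A)
  | _, ret a, _, exit, _ => .goto fun _ => exit a
  | _, push k s, _, exit, _ => .push (some k) (fun _ => s) (.goto fun _ => exit ())
  | _, pop k, _, exit, _ => .pop (some k) (fun _ o => o) (.goto exit)
  | _, bind c f, emb, exit, l =>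
    match l with
    | .inl l => c.code (fun l => emb (.inl l)) (fun a => emb (.inr ⟨a, (f a).entry⟩)) l
    | .inr ⟨a, l⟩ => (f a).code (fun l => emb (.inr ⟨a, l⟩)) exit l
  | _, loop f _, emb, exit, l =>
    match (show Σ a, (f a).Lab from l) with
    | ⟨a, l⟩ => (f a).code (fun l => emb ⟨a, l⟩) (Sum.elim (fun a => emb ⟨a, (f a).entry⟩) exit) l

variable [DecidableEq κ]

/-- `Runs c S t a S'`: started with the stacks `S`, the program `c` returns `a` with the stacks
`S'`, in at most `t` steps. -/
inductive Runs : {α : Type} → Cmd κ A α → (κ → List A) → ℕ → α → (κ → List A) → Prop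
  | ret {α : Type} {a : α} {S} : Runs (.ret a) S 1 a S
  | push {k s S} : Runs (.push k s) S 1 () (Function.update S k (s :: S k))
  | pop {k S} : Runs (.pop k) S 1 (S k).head? (Function.update S k (S k).tail)
  | bind {α β : Type} [Finite α] {c : Cmd κ A α} {f : α → Cmd κ A β} {S S' S'' t t' a b} :
    Runs c S t a S' → Runs (f a) S' t' b S'' → Runs (.bind c f) S (t + t') b S''
  | loop_next {α β : Type} [Finite α] {f : α → Cmd κ A (α ⊕ β)} {S S' S'' t t' a a' b} :
    Runs (f a) S t (.inl a') S' → Runs (.loop f a') S' t' b S'' →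
      Runs (.loop f a) S (t + t') b S''
  | loop_exit {α β : Type} [Finite α] {f : α → Cmd κ A (α ⊕ β)} {S S' t a b} :
    Runs (f a) S t (.inr b) S' → Runs (.loop f a) S t b S'
  | mono {α : Type} {c : Cmd κ A α} {S T t u a} : Runs c S t a T → t ≤ u → Runs c S u a T

/-- The stacks of the compiled machine, with an empty output stack. -/
def lift (S : κ → List A) : ∀ k, List (Alph κ A k)
  | none => []
  | some k => S k

theorem lift_update (S : κ → List A) (k : κ) (l : List A) :
    Function.update (lift S) (some k) l = lift (Function.update S k l) := by
  funext k'
  cases k' with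
  | none => rfl
  | some k' =>
    by_cases h : k' = k
    · subst h
      exact (Function.update_self ..).trans (Function.update_self k' l S).symm
    · refine (Function.update_of_ne (by simpa using h) ..).trans ?_
      exact (Function.update_of_ne h l S).symm

/-- Each primitive command is one machine step, while sequencing and looping are absorbed into the
jump targets and cost nothing. The embedding `emb` and the continuation `exit` are arbitrary because
the code of a subprogram lives inside a larger machine. The register content `v` is arbitrary
because it only carries a popped symbol to the jump that follows immediately. -/
theorem Runs.sound {α : Type} {c : Cmd κ A α} {S S' : κ → List A} {t : ℕ} {a : α}
    (h : Runs c S t a S') {Λ : Type} (M : Λ → TM2.Stmt (Alph κ A) Λ (Option A))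
    (emb : c.Lab → Λ) (exit : α → Λ) (hM : ∀ l, M (emb l) = c.code emb exit l) (v : Option A) :
    ∃ t' ≤ t, ∃ v', (flip Bind.bind (TM2.step M))^[t'] (some ⟨some (emb c.entry), v, lift S⟩) =
      some ⟨some (exit a), v', lift S'⟩ := by
  induction h generalizing v with
  | ret => exact ⟨1, le_rfl, v, by simp [flip, hM, code]⟩
  | @push k s S =>
    refine ⟨1, le_rfl, v, ?_⟩
    rw [← lift_update]
    simp only [Function.iterate_one, flip, Option.bind_eq_bind, Option.bind_some, TM2.step, hM]
    rfl
  | @pop k S =>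
    refine ⟨1, le_rfl, (S k).head?, ?_⟩
    rw [← lift_update]
    simp only [Function.iterate_one, flip, Option.bind_eq_bind, Option.bind_some, TM2.step, hM]
    rfl
  | @bind α β _ c f S S' S'' t t' a b _ _ ih1 ih2 =>
    obtain ⟨t1, ht1, v1, h1⟩ := ih1 (fun l => emb (.inl l))
      (fun a => emb (.inr ⟨a, (f a).entry⟩)) (fun l => hM _) v
    obtain ⟨t2, ht2, v2, h2⟩ := ih2 (fun l => emb (.inr ⟨a, l⟩)) exit (fun l => hM _) v1
    refine ⟨t2 + t1, by omega, v2, ?_⟩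
    rw [Function.iterate_add_apply, ← h2, ← h1]
    rfl
  | @loop_next α β _ f S S' S'' t t' a a' b _ _ ih1 ih2 =>
    obtain ⟨t1, ht1, v1, h1⟩ := ih1 (fun l => emb ⟨a, l⟩)
      (Sum.elim (fun a => emb ⟨a, (f a).entry⟩) exit) (fun l => hM _) v
    obtain ⟨t2, ht2, v2, h2⟩ := ih2 emb exit hM v1
    refine ⟨t2 + t1, by omega, v2, ?_⟩
    rw [Function.iterate_add_apply, ← h2]
    exact congrArg _ h1
  | @loop_exit α β _ f S S' t a b _ ih =>
    exact ih (fun l => emb ⟨a, l⟩) (Sum.elim (fun a => emb ⟨a, (f a).entry⟩) exit) (fun l => hM _) v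
  | mono _ hle ih =>
    obtain ⟨t1, ht1, h⟩ := ih emb exit hM v
    exact ⟨t1, ht1.trans hle, h⟩

/-- The machine that runs a program and then outputs the Boolean that the program returns. -/
noncomputable def machine [Fintype κ] [Fintype A] (c : Cmd κ A Bool) (inp : κ) : FinTM2 where
  K := Option κ
  k₀ := some inp
  k₁ := none
  Γ := Alph κ A
  Λ := c.Lab ⊕ Bool
  main := .inl c.entry
  ΛFin := by
    have := c.finite_lab
    exact Fintype.ofFinite _
  σ := Option A
  initialState := none
  Γk₀Fin := inferInstanceAs (Fintype A)
  m
    | .inl l => c.code .inl .inr l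
    | .inr b => .push none (fun _ => b) (.load (fun _ => none) .halt)

/-- All stacks must be empty at the end because a halting configuration may contain nothing but the
output. The extra `1` in the time bound is the step that pushes the Boolean and halts. -/
theorem computable [Fintype κ] [Fintype A] (c : Cmd κ A Bool) (inp : κ) {α : Type}
    (enc : α → List A) (f : α → Bool) (p : Polynomial ℕ)
    (h : ∀ a, Runs c (Function.update (fun _ => []) inp (enc a)) (p.eval (enc a).length) (f a)
      (fun _ => [])) :
    Nonempty (TM2ComputableInPolyTime enc Computability.encodeBool f) := by
  refine ⟨⟨⟨c.machine inp, Equiv.refl A, Equiv.refl Bool⟩, p + 1, fun a => ?_⟩⟩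
  have key := (h a).sound (c.machine inp).m Sum.inl Sum.inr (fun _ => rfl) none
  let t := key.choose
  have ht := key.choose_spec.1
  have h1 := key.choose_spec.2.choose_spec
  refine ⟨⟨t + 1, ?_⟩, by simpa using ht⟩
  rw [add_comm, Function.iterate_add_apply]
  have e : initList (c.machine inp) (List.map (Equiv.refl A).invFun (enc a)) =
      ⟨some (Sum.inl c.entry), none, lift (Function.update (fun _ => []) inp (enc a))⟩ := by
    unfold initList
    congr 1
    funext k
    cases k with
    | none => rfl
    | some k =>
      by_cases hk : k = inp
      · subst hk
        refine (dif_pos rfl).trans ?_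
        refine Eq.trans ?_ (Function.update_self k (enc a) (fun _ => [])).symm
        exact List.map_id (enc a)
      · refine (dif_neg fun h' => hk (Option.some.inj h')).trans ?_
        exact (Function.update_of_ne hk (enc a) (fun _ => [])).symm
  rw [e]
  refine (congrArg _ h1).trans ?_
  refine congrArg some ?_
  refine (congrArg₂ (TM2.Cfg.mk none) (rfl : none = (none : Option A)) ?_)
  funext k
  cases k with
  | none => exact (Function.update_self ..).trans rfl
  | some k => exact (Function.update_of_ne (Option.some_ne_none k) ..).trans rfl

end Cmd

open Cmd

/-! ### Stores of the model checker and timed execution -/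

/-- The stacks of the model checker: the input, the formula, the grid in reading order and in
reverse, the values saved for the next row, the values of the previous cell or row, the name that is
looked up, a scratch stack, and a unary counter. -/
inductive Stk where
  | inp | frm | fwd | rev | acc | prv | nam | tmp | cnt
  deriving DecidableEq

instance : Fintype Stk where
  elems := {.inp, .frm, .fwd, .rev, .acc, .prv, .nam, .tmp, .cnt}
  complete k := by cases k <;> simp

/-- The contents of the stacks of the model checker. -/
@[ext]
structure Store where
  inp : List Sym := []
  frm : List Sym := []
  fwd : List Sym := []
  rev : List Sym := []
  acc : List Sym := []
  prv : List Sym := []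
  nam : List Sym := []
  tmp : List Sym := []
  cnt : List Sym := []

namespace Store

/-- The content of a stack. -/
@[simp]
def get (S : Store) : Stk → List Sym
  | .inp => S.inp
  | .frm => S.frm
  | .fwd => S.fwd
  | .rev => S.rev
  | .acc => S.acc
  | .prv => S.prv
  | .nam => S.nam
  | .tmp => S.tmp
  | .cnt => S.cnt

/-- Replace the content of a stack. -/
@[simp]
def set (S : Store) (k : Stk) (l : List Sym) : Store :=
  match k with
  | .inp => { S with inp := l }
  | .frm => { S with frm := l }
  | .fwd => { S with fwd := l }
  | .rev => { S with rev := l }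
  | .acc => { S with acc := l }
  | .prv => { S with prv := l }
  | .nam => { S with nam := l }
  | .tmp => { S with tmp := l }
  | .cnt => { S with cnt := l }

theorem update_get (S : Store) (k : Stk) (l : List Sym) :
    Function.update S.get k l = (S.set k l).get := by
  funext k'
  cases k <;> cases k' <;> rfl

theorem set_get (S : Store) (k : Stk) : S.set k (S.get k) = S := by
  cases k <;> rfl

theorem get_set (S : Store) (k : Stk) (l : List Sym) : (S.set k l).get k = l := by
  cases k <;> rfl

theorem get_set_of_ne (S : Store) {k k' : Stk} (h : k' ≠ k) (l : List Sym) :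
    (S.set k l).get k' = S.get k' := by
  cases k <;> cases k' <;> first | rfl | exact absurd rfl h

theorem set_set (S : Store) (k : Stk) (l l' : List Sym) : (S.set k l).set k l' = S.set k l' := by
  cases k <;> rfl

theorem set_comm (S : Store) {k k' : Stk} (h : k' ≠ k) (l l' : List Sym) :
    (S.set k l).set k' l' = (S.set k' l').set k l := by
  cases k <;> cases k' <;> first | rfl | exact absurd rfl h

end Store

/-- Programs of the model checker. -/
abbrev Code (α : Type) := Cmd Stk Sym α

/-- `Ex c S t a T`: started on `S`, the program `c` returns `a` and leaves `T`, in time `t`. -/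
def Ex {α : Type} (c : Code α) (S : Store) (t : ℕ) (a : α) (T : Store) : Prop :=
  Runs c S.get t a T.get

/-- Run two programs one after the other. -/
abbrev seq {α β : Type} [Finite α] (c : Code α) (d : Code β) : Code β := bind c fun _ => d

namespace Ex

variable {α β : Type} {S S' S'' : Store} {t t' : ℕ}

theorem mono {c : Code α} {a : α} (h : Ex c S t a S') (ht : t ≤ t') : Ex c S t' a S' :=
  Runs.mono h ht

theorem ret {a : α} : Ex (.ret a) S 1 a S := Runs.ret

theorem push {k s} : Ex (.push k s) S 1 () (S.set k (s :: S.get k)) := by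
  unfold Ex
  rw [← Store.update_get]
  exact Runs.push

theorem pop {k} : Ex (.pop k) S 1 (S.get k).head? (S.set k (S.get k).tail) := by
  unfold Ex
  rw [← Store.update_get]
  exact Runs.pop

theorem pop_cons {k s l} (h : S.get k = s :: l) : Ex (.pop k) S 1 (some s) (S.set k l) := by
  have := pop (S := S) (k := k)
  rwa [h] at this

theorem pop_nil {k} (h : S.get k = []) : Ex (.pop k) S 1 none S := by
  have h2 : S.set k [] = S := by rw [← h, Store.set_get]
  have := pop (S := S) (k := k)
  rwa [h, List.tail_nil, h2] at this

theorem bind [Finite α] {c : Code α} {f : α → Code β} {a b T} (h : Ex c S t a S')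
    (h' : Ex (f a) S' t' b S'') (hT : t + t' ≤ T := by omega) : Ex (.bind c f) S T b S'' :=
  Runs.mono (Runs.bind h h') hT

end Ex

/-! ### Loops, and scanning, moving and copying stacks -/

section Loop

variable {α β : Type} [Finite α] {S S' S'' : Store} {t t' : ℕ} {a a' a'' : α} {f : α → Code (α ⊕ β)}

/-- Iterating the body of a loop leads from `S` and `a` to `S'` and `a'` in time `t`. -/
def Steps (f : α → Code (α ⊕ β)) (S : Store) (a : α) (t : ℕ) (S' : Store) (a' : α) : Prop :=
  ∀ t' b S'', Ex (.loop f a') S' t' b S'' → Ex (.loop f a) S (t + t') b S''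

theorem Steps.refl : Steps f S a t S a := fun _ _ _ h => h.mono (by omega)

theorem Steps.trans (h : Steps f S a t S' a') (h' : Steps f S' a' t' S'' a'') :
    Steps f S a (t + t') S'' a'' := fun t'' b T hT => by
  rw [add_assoc]
  exact h _ _ _ (h' _ _ _ hT)

theorem Steps.mono (h : Steps f S a t S' a') (ht : t ≤ t') : Steps f S a t' S' a' :=
  fun _ _ _ hT => (h _ _ _ hT).mono (by omega)

theorem Ex.steps (h : Ex (f a) S t (.inl a') S') : Steps f S a t S' a' :=
  fun _ _ _ hT => Runs.loop_next h hT

theorem Ex.loop_exit {b : β} (h : Ex (f a) S t (.inr b) S') : Ex (.loop f a) S t b S' :=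
  Runs.loop_exit h

theorem Steps.run {b : β} (h : Steps f S a t S' a') (h' : Ex (.loop f a') S' t' b S'') :
    Ex (.loop f a) S (t + t') b S'' := h _ _ _ h'

/-- The state is a family indexed by the number of pieces already consumed, and `rest` stays
arbitrary so that the pieces can be split off one at a time. -/
theorem Steps.range (St : ℕ → List Sym → Store) (w : ℕ → List Sym) (q L : ℕ)
    (h : ∀ i < L, ∀ rest, Steps f (St i (w i ++ rest)) a q (St (i + 1) rest) a) (rest : List Sym) :
    Steps f (St 0 ((List.range L).flatMap w ++ rest)) a (L * q) (St L rest) a := by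
  induction L generalizing rest with
  | zero => exact .refl
  | succ L ih =>
    rw [List.range_succ, List.flatMap_append, List.append_assoc]
    refine ((ih (fun i hi => h i (by omega)) _).trans ?_).mono (t := L * q + q) (by lia)
    simpa using h L (by omega) rest

end Loop

/-- The body of `scan`. -/
def scanBody {α : Type} [Finite α] (k : Stk) (halt : Sym → Bool) (h : Sym → Code α) (_ : Unit) :
    Code (Unit ⊕ Option Sym) :=
  .bind (.pop k) fun o =>
    match o with
    | none => .ret (.inr none)
    | some s => if halt s then .ret (.inr (some s)) else seq (h s) (.ret (.inl ()))

/-- Pop the symbols of the stack `k` and run `h` on each of them, until the stack is empty or a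
halt symbol has been popped. -/
def scan {α : Type} [Finite α] (k : Stk) (halt : Sym → Bool) (h : Sym → Code α) :
    Code (Option Sym) :=
  .loop (scanBody k halt h) ()

/-- Pop all symbols of the stack `k` and run `h` on each of them. -/
abbrev each {α : Type} [Finite α] (k : Stk) (h : Sym → Code α) : Code (Option Sym) :=
  scan k (fun _ => false) h

section Scan

variable {α : Type} [Finite α] {k y : Stk} {halt : Sym → Bool} {h : Sym → Code α} {S S' : Store}
  {t : ℕ} {s : Sym} {l r : List Sym} {a : α}

theorem Ex.scan_step (hk : S.get k = s :: l) (hs : halt s = false)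
    (hh : Ex (h s) (S.set k l) t a S') : Steps (scanBody k halt h) S () (t + 3) S' () := by
  refine Ex.steps (.bind (.pop_cons hk) (t' := t + 1) ?_)
  simp only [hs]
  exact .bind hh .ret

theorem Ex.scan_nil (hk : S.get k = []) : Ex (scan k halt h) S 2 none S := by
  refine Ex.loop_exit ?_
  unfold scanBody
  exact .bind (.pop_nil hk) .ret

theorem Ex.scan_stop (hk : S.get k = s :: l) (hs : halt s = true) :
    Ex (scan k halt h) S 2 (some s) (S.set k l) := by
  refine Ex.loop_exit ?_
  unfold scanBody
  refine .bind (.pop_cons hk) (t' := 1) ?_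
  simp only [hs]
  exact .ret

/-- Copying symbols from one stack to another while scanning. -/
theorem Steps.copy {h : Sym → Code Unit} (hne : y ≠ k) (hk : S.get k = l ++ r)
    (hl : ∀ s ∈ l, halt s = false) (hh : ∀ s ∈ l, h s = .push y s) :
    Steps (scanBody k halt h) S () (4 * l.length) ((S.set k r).set y (l.reverse ++ S.get y)) () := by
  induction l generalizing S with
  | nil =>
    have : (S.set k r).set y (S.get y) = S := by
      rw [List.nil_append] at hk
      rw [← hk, Store.set_get, Store.set_get]
    rw [List.reverse_nil, List.nil_append, this]
    exact Steps.refl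
  | cons s l ih =>
    have h1 : Ex (h s) (S.set k (l ++ r)) 1 ()
        ((S.set k (l ++ r)).set y (s :: S.get y)) := by
      rw [hh s (by simp)]
      have := Ex.push (S := S.set k (l ++ r)) (k := y) (s := s)
      rwa [Store.get_set_of_ne _ hne] at this
    have h2 := Ex.scan_step hk (hl s (by simp)) h1
    have h3 := ih (S := (S.set k (l ++ r)).set y (s :: S.get y))
      (by rw [Store.get_set_of_ne _ hne.symm, Store.get_set])
      (fun s hs => hl s (by simp [hs])) (fun s hs => hh s (by simp [hs]))
    have h4 := h2.trans h3
    rw [Store.get_set, Store.set_comm _ hne.symm, Store.set_set, Store.set_set] at h4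
    rw [List.reverse_cons, List.append_assoc, List.singleton_append, List.length_cons]
    exact h4.mono (by omega)

/-- Move the symbols of the stack `k` to the stack `y`, up to a halt symbol, which is removed. -/
abbrev move (k y : Stk) (halt : Sym → Bool) : Code (Option Sym) := scan k halt (.push y)

/-- Move all symbols of the stack `k` to the stack `y`. -/
abbrev pour (k y : Stk) : Code (Option Sym) := move k y fun _ => false

theorem ex_move (hne : y ≠ k) (hk : S.get k = l ++ s :: r) (hl : ∀ s ∈ l, halt s = false)
    (hs : halt s = true) :
    Ex (move k y halt) S (4 * l.length + 2) (some s) ((S.set k r).set y (l.reverse ++ S.get y)) := by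
  have h := (Steps.copy (h := Cmd.push y) hne hk hl (fun _ _ => rfl)).run
    (Ex.scan_stop (by rw [Store.get_set_of_ne _ hne.symm, Store.get_set]) hs)
  rwa [Store.set_comm _ hne.symm, Store.set_set] at h

theorem ex_pour (hne : y ≠ k) (hk : S.get k = l) :
    Ex (pour k y) S (4 * l.length + 2) none ((S.set k []).set y (l.reverse ++ S.get y)) :=
  (Steps.copy (h := .push y) (r := []) hne (by simpa using hk) (fun _ _ => rfl)
    (fun _ _ => rfl)).run
    (Ex.scan_nil (by rw [Store.get_set_of_ne _ hne.symm, Store.get_set]))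

/-- Empty a stack. -/
abbrev clear (k : Stk) : Code (Option Sym) := each k fun _ => .ret ()

theorem ex_clear (hk : S.get k = l) : Ex (clear k) S (4 * l.length + 2) none (S.set k []) := by
  induction l generalizing S with
  | nil =>
    have : S.set k [] = S := by rw [← hk, Store.set_get]
    rw [this]
    exact Ex.scan_nil hk
  | cons s l ih =>
    have := (Ex.scan_step (halt := fun _ => false) (h := fun _ => .ret ()) hk rfl .ret).run
      (ih (Store.get_set ..))
    rw [Store.set_set] at this
    exact this.mono (by rw [List.length_cons]; omega)

/-- Drop symbols up to and including a halt symbol. -/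
theorem ex_skip (hk : S.get k = l ++ s :: r) (hl : ∀ s ∈ l, halt s = false)
    (hs : halt s = true) :
    Ex (scan k halt fun _ => .ret ()) S (4 * l.length + 2) (some s) (S.set k r) := by
  induction l generalizing S with
  | nil => exact Ex.scan_stop hk hs
  | cons s' l ih =>
    have := (Ex.scan_step (halt := halt) (h := fun _ => .ret ()) hk (hl s' (by simp)) .ret).run
      (ih (Store.get_set ..) (fun s hs => hl s (by simp [hs])))
    rw [Store.set_set] at this
    exact this.mono (by rw [List.length_cons]; omega)

/-- Push the symbol `s` on `y` once for each symbol of the stack `k`, which is preserved with the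
help of the stack `t`. -/
def fill (k t y : Stk) (s : Sym) : Code (Option Sym) :=
  seq (each k fun a => seq (Cmd.push t a) (Cmd.push y s)) (pour t k)

/-- The stack `k` serves as a unary counter: it is unloaded onto `t` while being counted, then
poured back, and the two reversals cancel. -/
theorem ex_fill {k t y : Stk} {s : Sym} (hkt : k ≠ t) (hyk : y ≠ k) (hyt : y ≠ t)
    (hk : S.get k = l) (ht : S.get t = []) :
    Ex (fill k t y s) S (9 * l.length + 4) none
      (S.set y (List.replicate l.length s ++ S.get y)) := by
  -- In the middle of the count, `t` already holds a part `r` of the counter, so the induction needs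
  -- `r` arbitrary.
  have main : ∀ (l r : List Sym) (S : Store), S.get k = l → S.get t = r →
      Ex (each k fun a => seq (Cmd.push t a) (Cmd.push y s)) S (5 * l.length + 2) none
        (((S.set k []).set t (l.reverse ++ r)).set y
          (List.replicate l.length s ++ S.get y)) := by
    intro l
    induction l with
    | nil =>
      intro r S hk ht
      have : ((S.set k []).set t r).set y (S.get y) = S := by
        rw [← hk, Store.set_get, ← ht, Store.set_get, Store.set_get]
      rw [List.reverse_nil, List.nil_append, List.length_nil, List.replicate_zero, List.nil_append,
        this]
      exact Ex.scan_nil hk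
    | cons a l ih =>
      intro r S hk ht
      have h1 : Ex (seq (.push t a) (.push y s)) (S.set k l) 2 ()
          (((S.set k l).set t (a :: r)).set y (s :: S.get y)) := by
        have e1 := Ex.push (S := S.set k l) (k := t) (s := a)
        rw [Store.get_set_of_ne _ hkt.symm, ht] at e1
        have e2 := Ex.push (S := (S.set k l).set t (a :: r)) (k := y) (s := s)
        rw [Store.get_set_of_ne _ hyt, Store.get_set_of_ne _ hyk] at e2
        exact .bind e1 e2
      have h2 := ih (a :: r) (S := ((S.set k l).set t (a :: r)).set y (s :: S.get y))
        (by rw [Store.get_set_of_ne _ hyk.symm, Store.get_set_of_ne _ hkt, Store.get_set])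
        (by rw [Store.get_set_of_ne _ hyt.symm, Store.get_set])
      have h3 := (Ex.scan_step hk rfl h1).run h2
      rw [Store.get_set, Store.set_comm _ hyk.symm, Store.set_comm _ hkt, Store.set_set,
        Store.set_comm _ hyt.symm, Store.set_set, Store.set_set] at h3
      rw [List.length_cons, List.replicate_succ', List.reverse_cons, List.append_assoc,
        List.append_assoc]
      exact h3.mono (by omega)
  have h1 := main l [] S hk ht
  have h2 := ex_pour (k := t) (y := k) (l := l.reverse) hkt
    (S := ((S.set k []).set t (l.reverse ++ [])).set y (List.replicate l.length s ++ S.get y))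
    (by rw [Store.get_set_of_ne _ hyt.symm, Store.get_set, List.append_nil])
  have h3 := Ex.bind (f := fun _ => pour t k) h1 h2 le_rfl
  have e : ((((S.set k []).set t (l.reverse ++ [])).set y
      (List.replicate l.length s ++ S.get y)).set t []).set k
      (l.reverse.reverse ++ (((S.set k []).set t (l.reverse ++ [])).set y
        (List.replicate l.length s ++ S.get y)).get k) =
      S.set y (List.replicate l.length s ++ S.get y) := by
    rw [Store.get_set_of_ne _ hyk.symm, Store.get_set_of_ne _ hkt, Store.get_set,
      List.reverse_reverse, List.append_nil, Store.set_comm _ hyt.symm, Store.set_set,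
      Store.set_comm _ hyk.symm, Store.set_comm _ hkt, Store.set_set]
    congr 1
    have e1 : S.set k (l ++ []) = S := by rw [List.append_nil, ← hk, Store.set_get]
    have e2 : S.set t [] = S := by rw [← ht, Store.set_get]
    rw [e1, e2]
  rw [e] at h3
  exact h3.mono (by rw [List.length_reverse]; omega)

end Scan

/-! ### Compass semantics and stability of truth far from the origin -/

/-- The neighbour in direction `d`. -/
def Dir.move : Dir → ℤ × ℤ → ℤ × ℤ
  | .up, z => (z.1, z.2 + 1)
  | .down, z => (z.1, z.2 - 1)
  | .right, z => (z.1 + 1, z.2)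
  | .left, z => (z.1 - 1, z.2)

/-- The coordinate of a position in direction `d`. -/
def Dir.coord : Dir → ℤ × ℤ → ℤ
  | .up, z => z.2
  | .down, z => -z.2
  | .right, z => z.1
  | .left, z => -z.1

theorem Dir.rel_iff (d : Dir) (z w : ℤ × ℤ) : d.rel z w ↔ w = d.move z := by
  cases d <;> simp [Dir.rel, Dir.move, Prod.ext_iff]

theorem Dir.star_iff (d : Dir) (z w : ℤ × ℤ) :
    Relation.ReflTransGen d.rel z w ↔ ∃ k, w = d.move^[k] z := by
  constructor
  · intro h
    induction h with
    | refl => exact ⟨0, rfl⟩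
    | tail _ h ih =>
      obtain ⟨k, rfl⟩ := ih
      refine ⟨k + 1, ?_⟩
      rw [Function.iterate_succ_apply', (d.rel_iff _ _).1 h]
  · rintro ⟨k, rfl⟩
    induction k with
    | zero => exact .refl
    | succ k ih =>
      rw [Function.iterate_succ_apply']
      exact ih.tail ((d.rel_iff _ _).2 rfl)

section Sat

variable {Atm Agt : Type} (M : SpatialModel Atm Agt) (d : Dir) (φ : Formula Atm Agt) (z : ℤ × ℤ)

theorem sat_step : Sat M (.box (.step d) φ) z ↔ Sat M φ (d.move z) := by
  simp [Sat, Prog.rel, Dir.rel_iff]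

theorem sat_star : Sat M (.box (.star d) φ) z ↔ ∀ k, Sat M φ (d.move^[k] z) := by
  simp only [Sat, Prog.rel, Dir.star_iff]
  exact ⟨fun h k => h _ ⟨k, rfl⟩, by rintro h _ ⟨k, rfl⟩; exact h k⟩

/-- The fixpoint unfolding of the iterated box; it is both the recurrence that a sweep computes and
the tool for the opposite-direction case of stability. -/
theorem sat_star_move :
    Sat M (.box (.star d) φ) z ↔ Sat M φ z ∧ Sat M (.box (.star d) φ) (d.move z) := by
  simp only [sat_star]
  refine ⟨fun h => ⟨h 0, fun k => h (k + 1)⟩, fun h k => ?_⟩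
  cases k with
  | zero => exact h.1
  | succ k => exact h.2 k

end Sat

/-- From the coordinate `N` on, `Q` does not change in direction `d`. -/
def StableFrom (Q : ℤ × ℤ → Prop) (d : Dir) (N : ℤ) : Prop :=
  ∀ z, N ≤ d.coord z → (Q (d.move z) ↔ Q z)

theorem Dir.coord_move_self (d : Dir) (z : ℤ × ℤ) : d.coord (d.move z) = d.coord z + 1 := by
  cases d <;> simp [coord, move] <;> ring

/-- This loss of at most one is why the stability threshold may grow by one for each program symbol.
-/
theorem Dir.coord_move_ge (d e : Dir) (z : ℤ × ℤ) : e.coord z - 1 ≤ e.coord (d.move z) := by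
  cases d <;> cases e <;> simp only [coord, move] <;> omega

theorem Dir.move_comm (d e : Dir) (z : ℤ × ℤ) : d.move (e.move z) = e.move (d.move z) := by
  cases d <;> cases e <;> simp [move]

/-- The only direction that decreases the coordinate of `e` is the one opposite to `e`, and a step
in it undoes a step in `e`. -/
theorem Dir.coord_le_or (d e : Dir) :
    (∀ z, e.coord z ≤ e.coord (d.move z)) ∨ ∀ z, d.move (e.move z) = z := by
  cases d <;> cases e <;> simp [coord, move]

variable {Atm : Type} [Encodable Atm] {m : ℕ}

theorem formulaWord_length_pos (φ : Formula Atm (Fin m)) : 0 < (formulaWord φ).length := by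
  cases φ <;> simp [formulaWord, atomWord, hereWord]

/-- Beyond `n` there are neither agents nor facts, so names are false there. A step box moves at
most one unit back, which the extra symbol in the word pays for. An iterated box either looks along
a ray that stays in the stable region, or along one pointing back, and then the rays from two
adjacent points differ in a single point of that region. The word length is a generous bound, chosen
because the machine has it available in unary as the height of the formula stack. -/
theorem stableFrom_sat {M : SpatialModel Atm (Fin m)} {n : ℕ} (hM : M.Bounded n)
    (φ : Formula Atm (Fin m)) (e : Dir) :
    StableFrom (Sat M φ) e (n + (formulaWord φ).length) := by
  have out : ∀ z : ℤ × ℤ, (n : ℤ) < e.coord z → ¬ InBox n z := by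
    intro z hz h
    have h1 := abs_le.1 h.1
    have h2 := abs_le.1 h.2
    cases e <;> simp only [Dir.coord] at hz <;> omega
  induction φ with
  | atom p =>
    intro z hz
    have hp := formulaWord_length_pos (m := m) (Formula.atom p)
    have h1 : (n : ℤ) < e.coord z := by omega
    have h2 : (n : ℤ) < e.coord (e.move z) := by rw [Dir.coord_move_self]; omega
    simp [Sat, hM.2 _ (out _ h1), hM.2 _ (out _ h2)]
  | here i =>
    intro z hz
    have hp := formulaWord_length_pos (Formula.here (Atm := Atm) i)
    have h1 : (n : ℤ) < e.coord z := by omega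
    have h2 : (n : ℤ) < e.coord (e.move z) := by rw [Dir.coord_move_self]; omega
    have h3 : M.P i ≠ z := fun h => out _ h1 (h ▸ hM.1 i)
    have h4 : M.P i ≠ e.move z := fun h => out _ h2 (h ▸ hM.1 i)
    simp [Sat, h3, h4]
  | neg φ ih =>
    intro z hz
    simp only [formulaWord, List.length_cons] at hz
    exact not_congr (ih z (by push_cast at hz; omega))
  | and φ ψ ih1 ih2 =>
    intro z hz
    simp only [formulaWord, List.length_cons, List.length_append] at hz
    exact and_congr (ih1 z (by push_cast at hz; omega)) (ih2 z (by push_cast at hz; omega))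
  | box α φ ih =>
    intro z hz
    simp only [formulaWord, List.length_cons] at hz
    push_cast at hz
    cases α with
    | step d =>
      rw [sat_step, sat_step, Dir.move_comm]
      exact ih _ (by have := d.coord_move_ge e z; omega)
    | star d =>
      rcases d.coord_le_or e with h | h
      · rw [sat_star, sat_star]
        refine forall_congr' fun k => ?_
        have hk : e.coord z ≤ e.coord (d.move^[k] z) := by
          induction k with
          | zero => exact le_rfl
          | succ k ih => rw [Function.iterate_succ_apply']; exact ih.trans (h _)
        rw [Function.Commute.iterate_left (g := e.move) (fun z => d.move_comm e z) k z]
        exact ih _ (by omega)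
      -- Here `d` is opposite to `e`: the ray from `e.move z` is that point followed by the ray from
      -- `z`, and φ takes the same value at `e.move z` and `z`.
      · rw [sat_star_move, h, sat_star_move (z := z)]
        have := ih z (by omega)
        tauto

/-! ### Grids as words -/

/-- The symbol that starts the name of an agent (`true`) or of an atomic proposition (`false`). -/
def kindSym (b : Bool) : Sym := if b then .here else .atom

/-- The word for a name, given by its kind and its number. -/
def nameWord (q : Bool × List Bool) : List Sym := kindSym q.1 :: (q.2.map .bit ++ [.close])

/-- A cell that holds the values `bs` of formulas, and names. -/
def cellOf (bs : List Bool) (ns : List (Bool × List Bool)) : List Sym :=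
  .cell :: (bs.map .bit ++ ns.flatMap nameWord)

/-- The grid of side `2 * N + 1` with the cells `w`. -/
def grid (N : ℕ) (w : ℤ × ℤ → List Sym) : List Sym :=
  (List.range (2 * N + 1)).flatMap fun (j : ℕ) =>
    .row :: (List.range (2 * N + 1)).flatMap fun (i : ℕ) => w ((i : ℤ) - N, (j : ℤ) - N)

theorem range_flatMap_reverse {α : Type} (L : ℕ) (g : ℕ → List α) :
    ((List.range L).flatMap g).reverse =
      (List.range L).flatMap fun i => (g (L - 1 - i)).reverse := by
  have : (List.range L).reverse = (List.range L).map (fun i => L - 1 - i) := by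
    refine List.ext_getElem (by simp) fun i h1 h2 => by simp
  rw [List.reverse_flatMap, this, List.flatMap_map]
  rfl

/-- This is what a sweep over the reversed grid meets: positions in decreasing order, and each row
marker after the cells of its row. -/
theorem grid_reverse (N : ℕ) (w : ℤ × ℤ → List Sym) :
    (grid N w).reverse = (List.range (2 * N + 1)).flatMap fun (j : ℕ) =>
      (List.range (2 * N + 1)).flatMap (fun (i : ℕ) => (w ((N : ℤ) - i, (N : ℤ) - j)).reverse) ++
        [.row] := by
  unfold grid
  rw [range_flatMap_reverse]
  refine List.flatMap_congr fun j hj => ?_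
  rw [List.reverse_cons, range_flatMap_reverse]
  congr 1
  refine List.flatMap_congr fun i hi => ?_
  rw [List.mem_range] at hi hj
  congr 3 <;> omega

theorem grid_congr {N : ℕ} {w w' : ℤ × ℤ → List Sym} (h : ∀ z, InBox N z → w z = w' z) :
    grid N w = grid N w' := by
  unfold grid
  refine List.flatMap_congr fun j hj => ?_
  congr 1
  refine List.flatMap_congr fun i hi => ?_
  rw [List.mem_range] at hi hj
  exact h _ ⟨abs_le.2 (by simp only; omega), abs_le.2 (by simp only; omega)⟩

theorem length_flatMap_range_le {α : Type} {L q : ℕ} {g : ℕ → List α}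
    (h : ∀ i < L, (g i).length ≤ q) : ((List.range L).flatMap g).length ≤ L * q := by
  rw [List.length_flatMap]
  calc _ ≤ ((List.range L).map fun _ => q).sum :=
        List.sum_le_sum fun i hi => h i (List.mem_range.1 hi)
    _ = L * q := by simp

theorem length_grid_le {N q : ℕ} {w : ℤ × ℤ → List Sym} (h : ∀ z, InBox N z → (w z).length ≤ q) :
    (grid N w).length ≤ (2 * N + 1) * ((2 * N + 1) * q + 1) := by
  refine length_flatMap_range_le fun j hj => ?_
  rw [List.length_cons]
  refine Nat.add_le_add_right (length_flatMap_range_le fun i hi => ?_) 1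
  exact h _ ⟨abs_le.2 (by simp only; omega), abs_le.2 (by simp only; omega)⟩

/-! ### Sweeps over the grid -/

section Sweep

variable {α β σ : Type} [Finite α] {f : α → Code (α ⊕ β)} {a : α}

/-- A loop that processes the pieces `c i` of a source and puts the pieces `c' i` on a target,
while an auxiliary state changes. -/
theorem Steps.pieces (St : List Sym → List Sym → σ → Store) (c c' : ℕ → List Sym) (aux : ℕ → σ)
    (q L : ℕ) (h : ∀ i < L, ∀ src dst, Steps f (St (c i ++ src) dst (aux i)) a q
      (St src ((c' i).reverse ++ dst) (aux (i + 1))) a) (src dst : List Sym) :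
    Steps f (St ((List.range L).flatMap c ++ src) dst (aux 0)) a (L * q)
      (St src (((List.range L).flatMap c').reverse ++ dst) (aux L)) a := by
  refine Steps.range (fun i src => St src (((List.range i).flatMap c').reverse ++ dst) (aux i))
    c q L (fun i hi src => ?_) src
  simp only [List.range_succ, List.flatMap_append, List.reverse_append, List.append_assoc]
  simpa using h i hi src _

/-- A loop that sweeps over a grid. -/
theorem Steps.grid_fwd (St : List Sym → List Sym → σ → Store) (N : ℕ) (w w' : ℤ × ℤ → List Sym)
    (raux : ℕ → σ) (aux : ℕ → ℕ → σ) (q r : ℕ)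
    (haux : ∀ j, aux j (2 * N + 1) = raux (j + 1))
    (hr : ∀ j < 2 * N + 1, ∀ src dst, Steps f (St (.row :: src) dst (raux j)) a r
      (St src (.row :: dst) (aux j 0)) a)
    (hc : ∀ j < 2 * N + 1, ∀ i < 2 * N + 1, ∀ src dst,
      Steps f (St (w ((i : ℤ) - N, (j : ℤ) - N) ++ src) dst (aux j i)) a q
        (St src ((w' ((i : ℤ) - N, (j : ℤ) - N)).reverse ++ dst) (aux j (i + 1))) a) :
    Steps f (St (grid N w) [] (raux 0)) a ((2 * N + 1) * ((2 * N + 1) * q + r))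
      (St [] (grid N w').reverse (raux (2 * N + 1))) a := by
  have := Steps.pieces (f := f) (a := a) St
    (fun (j : ℕ) => Sym.row :: (List.range (2 * N + 1)).flatMap fun (i : ℕ) =>
      w ((i : ℤ) - N, (j : ℤ) - N))
    (fun (j : ℕ) => Sym.row :: (List.range (2 * N + 1)).flatMap fun (i : ℕ) =>
      w' ((i : ℤ) - N, (j : ℤ) - N)) raux ((2 * N + 1) * q + r) (2 * N + 1)
    (fun j hj src dst => ?_) [] []
  · simp only [List.append_nil] at this
    exact this
  · have h := (hr j hj ((List.range (2 * N + 1)).flatMap (fun (i : ℕ) =>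
      w ((i : ℤ) - N, (j : ℤ) - N)) ++ src) dst).trans
      (Steps.pieces St _ _ (aux j) q (2 * N + 1) (hc j hj) src (.row :: dst))
    rw [haux] at h
    rw [List.cons_append, List.reverse_cons, List.append_assoc]
    exact h.mono (by omega)

/-- A loop that sweeps over a grid in reverse. -/
theorem Steps.grid_rev (St : List Sym → List Sym → σ → Store) (N : ℕ) (w w' : ℤ × ℤ → List Sym)
    (raux : ℕ → σ) (aux : ℕ → ℕ → σ) (q r : ℕ)
    (haux : ∀ j, aux j 0 = raux j)
    (hr : ∀ j < 2 * N + 1, ∀ src dst, Steps f (St (.row :: src) dst (aux j (2 * N + 1))) a r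
      (St src (.row :: dst) (raux (j + 1))) a)
    (hc : ∀ j < 2 * N + 1, ∀ i < 2 * N + 1, ∀ src dst,
      Steps f (St ((w ((N : ℤ) - i, (N : ℤ) - j)).reverse ++ src) dst (aux j i)) a q
        (St src (w' ((N : ℤ) - i, (N : ℤ) - j) ++ dst) (aux j (i + 1))) a) :
    Steps f (St (grid N w).reverse [] (raux 0)) a ((2 * N + 1) * ((2 * N + 1) * q + r))
      (St [] (grid N w') (raux (2 * N + 1))) a := by
  have := Steps.pieces (f := f) (a := a) St
    (fun (j : ℕ) => (List.range (2 * N + 1)).flatMap (fun (i : ℕ) =>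
      (w ((N : ℤ) - i, (N : ℤ) - j)).reverse) ++ [.row])
    (fun (j : ℕ) => (List.range (2 * N + 1)).flatMap (fun (i : ℕ) =>
      (w' ((N : ℤ) - i, (N : ℤ) - j)).reverse) ++ [.row])
    raux ((2 * N + 1) * q + r) (2 * N + 1)
    (fun j hj src dst => ?_) [] []
  · simp only [← grid_reverse, List.append_nil, List.reverse_reverse] at this
    exact this
  · have h := (Steps.pieces St (fun (i : ℕ) => (w ((N : ℤ) - i, (N : ℤ) - j)).reverse)
      (fun (i : ℕ) => (w' ((N : ℤ) - i, (N : ℤ) - j)).reverse) (aux j) q (2 * N + 1)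
      (fun i hi src dst => by
        rw [List.reverse_reverse]; exact hc j hj i hi src dst) (.row :: src) dst).trans
      (hr j hj src _)
    rw [haux] at h
    rw [List.append_assoc, List.reverse_append]
    exact h

end Sweep

theorem Ex.conv {α : Type} {c : Code α} {S S' S'' : Store} {t : ℕ} {a : α} (h : Ex c S t a S')
    (e : S' = S'') : Ex c S t a S'' := e ▸ h

theorem Steps.conv {α β : Type} [Finite α] {f : α → Code (α ⊕ β)} {S S' S'' : Store} {t : ℕ}
    {a b : α} (h : Steps f S a t S' b) (e : S' = S'') : Steps f S a t S'' b := by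
  subst e
  exact h

/-- What to do with each symbol in a sweep over the grid: run `onCell` and `onRow` at the symbols
that start cells and rows, and copy all symbols to the stack `y`. -/
def sweep (onCell onRow : Code Unit) (y : Stk) : Sym → Code Unit
  | .cell => seq onCell (.push y .cell)
  | .row => seq onRow (.push y .row)
  | s => .push y s

theorem sweep_eq (onCell onRow : Code Unit) (y : Stk) {s : Sym} (h1 : s ≠ .cell) (h2 : s ≠ .row) :
    sweep onCell onRow y s = .push y s := by
  cases s <;> first | rfl | contradiction

theorem mem_nameWord {q : Bool × List Bool} {s : Sym} (h : s ∈ nameWord q) :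
    s = kindSym q.1 ∨ (∃ b, s = .bit b) ∨ s = .close := by
  simp only [nameWord, List.mem_cons, List.mem_append, List.mem_map, List.not_mem_nil, or_false] at h
  rcases h with h | ⟨b, _, h⟩ | h
  · exact .inl h
  · exact .inr (.inl ⟨b, h.symm⟩)
  · exact .inr (.inr h)

theorem kindSym_ne (b : Bool) : kindSym b ≠ .cell ∧ kindSym b ≠ .row ∧ kindSym b ≠ .sep ∧
    kindSym b ≠ .close ∧ ∀ c, kindSym b ≠ .bit c := by
  cases b <;> simp [kindSym]

/-- The symbols of a cell after the first one. -/
theorem mem_cellOf_tail {bs : List Bool} {ns : List (Bool × List Bool)} {s : Sym}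
    (h : s ∈ bs.map Sym.bit ++ ns.flatMap nameWord) : s ≠ .cell ∧ s ≠ .row ∧ s ≠ .sep := by
  simp only [List.mem_append, List.mem_map, List.mem_flatMap] at h
  rcases h with ⟨b, _, rfl⟩ | ⟨q, _, h⟩
  · simp
  · rcases mem_nameWord h with rfl | ⟨b, rfl⟩ | rfl
    · exact ⟨(kindSym_ne _).1, (kindSym_ne _).2.1, (kindSym_ne _).2.2.1⟩
    all_goals simp

/-- With `m` bounding the side and the cell length, and since `m ≥ 1`, the terms add up to at most
`30 + 30 + 4 + 4 + 30` multiples of `m ^ 3`. The last summand covers pouring the grid from one stack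
to the other and the final clean-up. -/
theorem sweep_cost {N m q r t : ℕ} {w : ℤ × ℤ → List Sym} (hN : 2 * N + 1 ≤ m)
    (hw : ∀ z, InBox N z → (w z).length ≤ m) (hq : q ≤ 30 * m) (hr : r ≤ 30 * m) (ht : t ≤ 30 * m) :
    (2 * N + 1) * ((2 * N + 1) * q + r) + (4 * (grid N w).length + t) ≤ 100 * m ^ 3 := by
  have h1 : (2 * N + 1) * ((2 * N + 1) * q + r) ≤ m * (m * (30 * m) + 30 * m) := by gcongr
  have h2 : (grid N w).length ≤ m * (m * m + 1) := (length_grid_le hw).trans (by gcongr)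
  have h3 : 1 ≤ m := by omega
  have h4 : m ≤ m ^ 2 := by nlinarith
  have h5 : m ^ 2 ≤ m ^ 3 := by nlinarith [Nat.zero_le (m ^ 2)]
  nlinarith

section

variable {N m : ℕ} {b b' : ℤ × ℤ → List Bool} {ns : ℤ × ℤ → List (Bool × List Bool)}

/-- A reverse sweep, during which the stacks `acc` and `prv` contain `aux j i` before the cell `i`
of the row `j`. -/
theorem ex_sweep_rev {onCell onRow : Code Unit} (S : Store) (aux : ℕ → ℕ → List Sym × List Sym)
    {r : ℕ} (hm : ∀ z, InBox N z → (cellOf (b z) (ns z)).length ≤ m)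
    (hc : ∀ j < 2 * N + 1, ∀ i < 2 * N + 1, ∀ (S : Store) T,
      S.fwd = (b ((N : ℤ) - i, (N : ℤ) - j)).map Sym.bit ++ T →
      S.acc = (aux j i).1 → S.prv = (aux j i).2 →
      Ex onCell S 8 () { S with
        fwd := (b' ((N : ℤ) - i, (N : ℤ) - j)).map Sym.bit ++ T
        acc := (aux j (i + 1)).1
        prv := (aux j (i + 1)).2 })
    (hr : ∀ j < 2 * N + 1, ∀ S : Store, S.acc = (aux j (2 * N + 1)).1 →
      S.prv = (aux j (2 * N + 1)).2 →
      Ex onRow S r () { S with acc := (aux (j + 1) 0).1, prv := (aux (j + 1) 0).2 }) :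
    Ex (each .rev (sweep onCell onRow .fwd))
      { S with
        fwd := []
        rev := (grid N fun z => cellOf (b z) (ns z)).reverse
        acc := (aux 0 0).1
        prv := (aux 0 0).2 }
      ((2 * N + 1) * ((2 * N + 1) * (4 * m + 12) + (r + 4)) + 2) none
      { S with
        fwd := grid N fun z => cellOf (b' z) (ns z)
        rev := []
        acc := (aux (2 * N + 1) 0).1
        prv := (aux (2 * N + 1) 0).2 } := by
  refine Steps.run (Steps.grid_rev (f := scanBody .rev (fun _ => false) (sweep onCell onRow .fwd))
    (a := ()) (fun src dst (x : List Sym × List Sym) =>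
      { S with rev := src, fwd := dst, acc := x.1, prv := x.2 }) N
    (fun z => cellOf (b z) (ns z)) (fun z => cellOf (b' z) (ns z)) (fun j => aux j 0) aux
    (4 * m + 12) (r + 4) (fun _ => rfl) (fun j hj src dst => ?_)
    (fun j hj i hi src dst => ?_)) (Ex.scan_nil rfl)
  · refine Ex.scan_step (s := .row) (l := src) (a := ()) rfl rfl ?_ (t := r + 1)
    change Ex (seq onRow (.push .fwd .row)) _ _ _ _
    exact Ex.bind (hr j hj _ rfl rfl) .push
  · have hz : InBox N ((N : ℤ) - i, (N : ℤ) - j) :=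
      ⟨abs_le.2 (by simp only; omega), abs_le.2 (by simp only; omega)⟩
    have hlen := hm _ hz
    have h := hc j hj i hi
    generalize ((N : ℤ) - i, (N : ℤ) - j) = z at hz hlen h ⊢
    simp only [cellOf, List.length_cons] at hlen ⊢
    -- In reverse the marker `.cell` comes last, so when it is read the values of the cell have just
    -- arrived on top of `fwd`, where `onCell` edits them.
    have e1 := Steps.copy (k := .rev) (y := .fwd) (halt := fun _ => false)
      (h := sweep onCell onRow .fwd)
      (l := ((b z).map Sym.bit ++ (ns z).flatMap nameWord).reverse)
      (r := .cell :: src) (S := { S with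
        rev := (Sym.cell :: ((b z).map Sym.bit ++ (ns z).flatMap nameWord)).reverse ++ src
        fwd := dst
        acc := (aux j i).1
        prv := (aux j i).2 })
      (by decide) (by simp) (fun _ _ => rfl) (fun s hs => by
        have := mem_cellOf_tail (List.mem_reverse.1 hs)
        exact sweep_eq _ _ _ this.1 this.2.1)
    refine (e1.trans (t' := 12) (Ex.scan_step (s := .cell) (l := src) (a := ()) rfl rfl
      (t := 9) ?_)).mono ?_
    · change Ex (seq onCell (.push .fwd .cell)) _ _ _ _
      have e2 := h { S with
        rev := src
        fwd := (b z).map Sym.bit ++ ((ns z).flatMap nameWord ++ dst)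
        acc := (aux j i).1
        prv := (aux j i).2 } _ rfl rfl rfl
      refine (Ex.bind (t := 8) (t' := 1) (S' := { S with
        rev := src
        fwd := (b' z).map Sym.bit ++ ((ns z).flatMap nameWord ++ dst)
        acc := (aux j (i + 1)).1
        prv := (aux j (i + 1)).2 }) (a := ()) ?_ .push).conv ?_
      · refine Eq.mp ?_ e2
        simp
      · simp
    · rw [List.length_reverse]
      omega

/-- A forward sweep, during which the stacks `acc` and `prv` contain `aux j i` before the cell `i`
of the row `j`. -/
theorem ex_sweep_fwd {onCell onRow : Code Unit} (S : Store) (raux : ℕ → List Sym × List Sym)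
    (aux : ℕ → ℕ → List Sym × List Sym) {r : ℕ}
    (hb : ∀ z, InBox N z → (b' z).length = (b z).length)
    (hm : ∀ z, InBox N z → (cellOf (b z) (ns z)).length ≤ m)
    (haux : ∀ j, aux j (2 * N + 1) = raux (j + 1))
    (hc : ∀ j < 2 * N + 1, ∀ i < 2 * N + 1, ∀ (S : Store) T,
      S.fwd = (b ((i : ℤ) - N, (j : ℤ) - N)).map Sym.bit ++ T →
      S.acc = (aux j i).1 → S.prv = (aux j i).2 →
      Ex onCell S 8 () { S with
        fwd := (b' ((i : ℤ) - N, (j : ℤ) - N)).map Sym.bit ++ T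
        acc := (aux j (i + 1)).1
        prv := (aux j (i + 1)).2 })
    (hr : ∀ j < 2 * N + 1, ∀ S : Store, S.acc = (raux j).1 → S.prv = (raux j).2 →
      Ex onRow S r () { S with acc := (aux j 0).1, prv := (aux j 0).2 }) :
    Ex (each .fwd (sweep onCell onRow .rev))
      { S with
        fwd := grid N fun z => cellOf (b z) (ns z)
        rev := []
        acc := (raux 0).1
        prv := (raux 0).2 }
      ((2 * N + 1) * ((2 * N + 1) * (4 * m + 12) + (r + 4)) + 2) none
      { S with
        fwd := []
        rev := (grid N fun z => cellOf (b' z) (ns z)).reverse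
        acc := (raux (2 * N + 1)).1
        prv := (raux (2 * N + 1)).2 } := by
  refine Steps.run (Steps.grid_fwd (f := scanBody .fwd (fun _ => false) (sweep onCell onRow .rev))
    (a := ()) (fun src dst (x : List Sym × List Sym) =>
      { S with fwd := src, rev := dst, acc := x.1, prv := x.2 }) N
    (fun z => cellOf (b z) (ns z)) (fun z => cellOf (b' z) (ns z)) raux aux
    (4 * m + 12) (r + 4) haux (fun j hj src dst => ?_)
    (fun j hj i hi src dst => ?_)) (Ex.scan_nil rfl)
  · refine Ex.scan_step (s := .row) (l := src) (a := ()) rfl rfl ?_ (t := r + 1)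
    change Ex (seq onRow (.push .rev .row)) _ _ _ _
    exact Ex.bind (hr j hj _ rfl rfl) .push
  · have hz : InBox N ((i : ℤ) - N, (j : ℤ) - N) :=
      ⟨abs_le.2 (by simp only; omega), abs_le.2 (by simp only; omega)⟩
    have hlen := hm _ hz
    have hb := hb _ hz
    have h := hc j hj i hi
    generalize ((i : ℤ) - N, (j : ℤ) - N) = z at hz hb hlen h ⊢
    simp only [cellOf, List.length_cons] at hlen ⊢
    have e1 := Steps.copy (k := .fwd) (y := .rev) (halt := fun _ => false)
      (h := sweep onCell onRow .rev)
      (l := (b' z).map Sym.bit ++ (ns z).flatMap nameWord)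
      (r := src) (S := { S with
        fwd := (b' z).map Sym.bit ++ ((ns z).flatMap nameWord ++ src)
        rev := .cell :: dst
        acc := (aux j (i + 1)).1
        prv := (aux j (i + 1)).2 })
      (by decide) (by simp) (fun _ _ => rfl) (fun s hs => by
        have := mem_cellOf_tail hs
        exact sweep_eq _ _ _ this.1 this.2.1)
    -- Going forward the marker comes first: the values are still on top of the source `fwd`, are
    -- edited there, and are copied afterwards. So `onCell` works on `fwd` in both kinds of sweep.
    refine ((Ex.scan_step (s := .cell)
      (l := (b z).map Sym.bit ++ ((ns z).flatMap nameWord ++ src)) (a := ()) (by simp) rfl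
      (t := 9) ?_).trans (e1.conv ?_)).mono ?_
    · change Ex (seq onCell (.push .rev .cell)) _ _ _ _
      exact Ex.bind (h { S with
        fwd := (b z).map Sym.bit ++ ((ns z).flatMap nameWord ++ src)
        rev := dst
        acc := (aux j i).1
        prv := (aux j i).2 } _ rfl rfl rfl) .push
    · simp
    · simp only [List.length_append, List.length_map] at hlen ⊢
      omega

/-- Rewrite the values in each cell by `onCell`. -/
def localPass (onCell : Code Unit) : Code (Option Sym) :=
  seq (pour .fwd .rev) (each .rev (sweep onCell (.ret ()) .fwd))

theorem ex_localPass {onCell : Code Unit} (S : Store)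
    (hm : ∀ z, InBox N z → (cellOf (b z) (ns z)).length ≤ m) (hN : 2 * N + 1 ≤ m)
    (h : ∀ z, InBox N z → ∀ S T, S.fwd = (b z).map Sym.bit ++ T →
      Ex onCell S 8 () { S with fwd := (b' z).map Sym.bit ++ T }) :
    Ex (localPass onCell)
      { S with fwd := grid N fun z => cellOf (b z) (ns z), rev := [], acc := [], prv := [] }
      (100 * m ^ 3) none
      { S with fwd := grid N fun z => cellOf (b' z) (ns z), rev := [], acc := [], prv := [] } := by
  have h2 := ex_pour (k := .fwd) (y := .rev)
    (S := { S with fwd := grid N fun z => cellOf (b z) (ns z), rev := [], acc := [], prv := [] })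
    (by decide) rfl
  have h1 := ex_sweep_rev (onCell := onCell) (onRow := .ret ()) (r := 1) (b' := b') S (fun _ _ => ([], [])) hm
    (fun j hj i hi S T hS h1 h2 => ?_) (fun j _ S h1 h2 => ?_)
  · refine Ex.bind (h2.conv ?_) h1
      ((sweep_cost (t := 4) (q := 4 * m + 12) (r := 1 + 4) hN hm ?_ ?_ ?_).trans' ?_)
    · simp
    any_goals omega
    simp only [Store.get]
    omega
  · refine (h _ ⟨abs_le.2 (by simp only; omega), abs_le.2 (by simp only; omega)⟩ S T hS).conv ?_
    simp only at h1 h2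
    rw [← h1]; congr 1; rw [h2, h1]
  · refine Ex.ret.conv ?_
    simp only at h1 h2
    ext1 <;> simp [h1, h2]

end

/-! ### Computing a box by one sweep -/

/-- The Boolean that a symbol stands for. -/
def readBit : Option Sym → Option Bool
  | some (.bit b) => some b
  | _ => none

/-- The new value at a position with the value `b`, when `p` has been saved at its neighbour. -/
def combine (star : Bool) (p : Option Bool) (b : Bool) : Bool :=
  if star then p.getD true && b else p.getD b

/-- The work at one cell in a sweep for a program. The value for the next cell (or row) is saved on
the stack `y`. -/
def dirCell (star : Bool) (y : Stk) : Code Unit :=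
  .bind (.pop .fwd) fun s => .bind (.pop .prv) fun p =>
    seq (.push .fwd (.bit (combine star (readBit p) ((readBit s).getD false))))
      (.push y (.bit
        (if star then combine star (readBit p) ((readBit s).getD false)
          else (readBit s).getD false)))

/-- The work between two rows in a sweep for a program. -/
def dirRow : Code Unit := seq (clear .prv) (seq (pour .acc .prv) (.ret ()))

/-- Is this a vertical direction? -/
def Dir.vert : Dir → Bool
  | .up | .down => true
  | .left | .right => false

/-- Is the reading order of the grid opposite to this direction? -/
def Dir.back : Dir → Bool
  | .up | .right => true
  | .down | .left => false

/-- Apply the program `d` (or its iteration) to the first values in all cells. -/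
def dirPass (star : Bool) (d : Dir) : Code (Option Sym) :=
  seq
    (if d.back then
      seq (pour .fwd .rev)
        (each .rev (sweep (dirCell star (if d.vert then .acc else .prv)) dirRow .fwd))
    else
      seq (each .fwd (sweep (dirCell star (if d.vert then .acc else .prv)) dirRow .rev))
        (pour .rev .fwd))
    (seq (clear .acc) (clear .prv))

theorem ex_dirCell_acc {star b : Bool} {S : Store} {T : List Sym} (h : S.fwd = .bit b :: T) :
    Ex (dirCell star .acc) S 8 () { S with
      fwd := .bit (combine star (readBit S.prv.head?) b) :: T
      acc := .bit (if star then combine star (readBit S.prv.head?) b else b) :: S.acc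
      prv := S.prv.tail } := by
  refine Ex.bind (t := 1) (t' := 7) (Ex.pop_cons h) ?_
  refine Ex.bind (t := 1) (t' := 6) Ex.pop ?_
  exact Ex.bind (t := 1) (t' := 1) Ex.push Ex.push

theorem ex_dirCell_prv {star b : Bool} {S : Store} {T : List Sym} (h : S.fwd = .bit b :: T) :
    Ex (dirCell star .prv) S 8 () { S with
      fwd := .bit (combine star (readBit S.prv.head?) b) :: T
      prv := .bit (if star then combine star (readBit S.prv.head?) b else b) :: S.prv.tail } := by
  refine Ex.bind (t := 1) (t' := 7) (Ex.pop_cons h) ?_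
  refine Ex.bind (t := 1) (t' := 6) Ex.pop ?_
  exact Ex.bind (t := 1) (t' := 1) Ex.push Ex.push

theorem ex_dirRow {S : Store} : Ex dirRow S (4 * S.acc.length + 4 * S.prv.length + 8) ()
    { S with acc := [], prv := S.acc.reverse } := by
  refine Ex.bind (ex_clear (l := S.prv) rfl)
    (Ex.bind (ex_pour (l := S.acc) (by decide) rfl) (Ex.ret.conv ?_) le_rfl)
  simp

section

variable (vert : Bool) (L : ℕ) (g : ℕ → ℕ → Bool)

/-- The contents of the stacks `acc` and `prv` before the cell `i` of the row `j`, when `g j i` is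
the value that is saved there. -/
def sweepAux (j i : ℕ) : List Sym × List Sym :=
  if vert then
    (((List.range i).map fun i => .bit (g j i)).reverse,
      if j = 0 then [] else (List.range' i (L - i)).map fun i => .bit (g (j - 1) i))
  else ([], if i = 0 then [] else [.bit (g j (i - 1))])

theorem length_sweepAux_le {j i : ℕ} (hi : i ≤ L) :
    (sweepAux vert L g j i).1.length ≤ L ∧ (sweepAux vert L g j i).2.length ≤ L + 1 := by
  unfold sweepAux
  split_ifs <;> simp <;> omega

theorem sweepAux_zero : sweepAux vert L g 0 0 = ([], []) := by
  unfold sweepAux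
  split_ifs <;> simp_all

/-- Vertically, the row just saved lies newest first on `acc`; reversing it gives the order in which
the next row asks for it. Horizontally `acc` is empty, so nothing leaks into the next row. -/
theorem sweepAux_row (j : ℕ) :
    sweepAux vert L g (j + 1) 0 = ([], (sweepAux vert L g j L).1.reverse) := by
  unfold sweepAux
  split_ifs <;> simp_all [List.range_eq_range']

/-- The top of `prv` belongs to the neighbour visited before, in the previous row or just now, and
is absent exactly at the border where the sweep starts. -/
theorem sweepAux_head {j i : ℕ} (hi : i < L) :
    readBit (sweepAux vert L g j i).2.head? =
      if vert then (if j = 0 then none else some (g (j - 1) i))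
      else if i = 0 then none else some (g j (i - 1)) := by
  unfold sweepAux
  obtain ⟨k, hk⟩ : ∃ k, L - i = k + 1 := ⟨L - i - 1, by omega⟩
  split_ifs <;> simp [readBit, hk, List.range'_succ]

theorem sweepAux_succ {j i : ℕ} (hi : i < L) :
    sweepAux vert L g j (i + 1) =
      if vert then (.bit (g j i) :: (sweepAux vert L g j i).1, (sweepAux vert L g j i).2.tail)
      else ((sweepAux vert L g j i).1, .bit (g j i) :: (sweepAux vert L g j i).2.tail) := by
  unfold sweepAux
  obtain ⟨k, hk⟩ : ∃ k, L - i = k + 1 := ⟨L - i - 1, by omega⟩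
  have hk' : L - (i + 1) = k := by omega
  split_ifs <;> simp_all [List.range'_succ, List.range_succ]

end

section

variable {N m : ℕ} {f new : ℤ × ℤ → Bool} {bs : ℤ × ℤ → List Bool}
  {ns : ℤ × ℤ → List (Bool × List Bool)} {star : Bool} {d : Dir}

/-- Here `z j i` is the position visited at index `i` of row `j`. By `hz0` and `hz1` the sweep
starts at the border with coordinate `N` and moves against `d`, so the `d`-neighbour has already
been visited. `hnew` is the recurrence: an iterated box needs the new value of the neighbour, a
single step its old value. -/
theorem ex_dirCell {z : ℕ → ℕ → ℤ × ℤ} (hz : ∀ j < 2 * N + 1, ∀ i < 2 * N + 1, InBox N (z j i))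
    (hz0 : ∀ j i, d.coord (z j i) = N - (if d.vert then j else i : ℕ))
    (hz1 : ∀ j i, z j i = d.move (if d.vert then z (j + 1) i else z j (i + 1)))
    (hnew : ∀ z, InBox N z → new z = combine star (if d.coord z < N then
      some (if star then new (d.move z) else f (d.move z)) else none) (f z))
    {j i : ℕ} (hj : j < 2 * N + 1) (hi : i < 2 * N + 1) {S : Store} {T : List Sym}
    (hS : S.fwd = (f (z j i) :: bs (z j i)).map Sym.bit ++ T)
    (h1 : S.acc = (sweepAux d.vert (2 * N + 1)
      (fun j i => if star then new (z j i) else f (z j i)) j i).1)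
    (h2 : S.prv = (sweepAux d.vert (2 * N + 1)
      (fun j i => if star then new (z j i) else f (z j i)) j i).2) :
    Ex (dirCell star (if d.vert then .acc else .prv)) S 8 () { S with
      fwd := (new (z j i) :: bs (z j i)).map Sym.bit ++ T
      acc := (sweepAux d.vert (2 * N + 1)
        (fun j i => if star then new (z j i) else f (z j i)) j (i + 1)).1
      prv := (sweepAux d.vert (2 * N + 1)
        (fun j i => if star then new (z j i) else f (z j i)) j (i + 1)).2 } := by
  have key : combine star (readBit S.prv.head?) (f (z j i)) = new (z j i) := by
    rw [h2, sweepAux_head _ _ _ hi, hnew _ (hz j hj i hi), hz0]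
    congr 1
    cases hv : d.vert <;> simp only [hv, Bool.false_eq_true, if_true, if_false] at hz1 ⊢
    · rcases i with _ | i
      · simp
      · have h : (N : ℤ) - (i + 1 : ℕ) < N := by push_cast; omega
        rw [if_neg (Nat.succ_ne_zero i), if_pos h, Nat.add_sub_cancel, hz1 j i]
    · rcases j with _ | j
      · simp
      · have h : (N : ℤ) - (j + 1 : ℕ) < N := by push_cast; omega
        rw [if_neg (Nat.succ_ne_zero j), if_pos h, Nat.add_sub_cancel, hz1 j i]
  rw [sweepAux_succ _ _ _ hi, ← h1, ← h2]
  cases d.vert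
  · refine (ex_dirCell_prv hS).conv ?_
    simp [key]
  · refine (ex_dirCell_acc hS).conv ?_
    simp [key]

/-- For the directions up and right the neighbour comes later in reading order, so the reversed
sweep meets it first; `Dir.pos_not_back` is the mirror image. -/
theorem Dir.pos_back (hd : d.back = true) (j i : ℕ) :
    d.coord ((N : ℤ) - i, (N : ℤ) - j) = N - (if d.vert then j else i : ℕ) ∧
      ((N : ℤ) - i, (N : ℤ) - j) = d.move (if d.vert then ((N : ℤ) - i, (N : ℤ) - (j + 1 : ℕ))
        else ((N : ℤ) - (i + 1 : ℕ), (N : ℤ) - j)) := by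
  cases d <;> simp [back, coord, move, vert] at hd ⊢ <;> ring

theorem Dir.pos_not_back (hd : d.back = false) (j i : ℕ) :
    d.coord ((i : ℤ) - N, (j : ℤ) - N) = N - (if d.vert then j else i : ℕ) ∧
      ((i : ℤ) - N, (j : ℤ) - N) = d.move (if d.vert then ((i : ℤ) - N, ((j + 1 : ℕ) : ℤ) - N)
        else (((i + 1 : ℕ) : ℤ) - N, (j : ℤ) - N)) := by
  cases d <;> simp [back, coord, move, vert] at hd ⊢ <;> ring

/-- Any `new` satisfying the recurrence from the border inwards is what the sweep writes. The stack
for the saved values starts and ends empty, and the lower entries `bs` of each cell are untouched.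
-/
theorem ex_dirPass (S : Store) (hN : 2 * N + 1 ≤ m)
    (hm : ∀ z, InBox N z → (cellOf (f z :: bs z) (ns z)).length ≤ m)
    (hnew : ∀ z, InBox N z → new z = combine star (if d.coord z < N then
      some (if star then new (d.move z) else f (d.move z)) else none) (f z)) :
    Ex (dirPass star d)
      { S with
        fwd := grid N fun z => cellOf (f z :: bs z) (ns z), rev := [], acc := [], prv := [] }
      (100 * m ^ 3) none
      { S with
        fwd := grid N fun z => cellOf (new z :: bs z) (ns z), rev := [], acc := [], prv := [] } := by
  have hm' : ∀ z, InBox N z → (cellOf (new z :: bs z) (ns z)).length ≤ m := hm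
  cases hd : d.back
  · set aux := sweepAux d.vert (2 * N + 1) fun j i =>
      if star then new ((i : ℤ) - N, (j : ℤ) - N) else f ((i : ℤ) - N, (j : ℤ) - N) with haux
    have hl : ∀ j i, i ≤ 2 * N + 1 →
        (aux j i).1.length ≤ 2 * N + 1 ∧ (aux j i).2.length ≤ 2 * N + 1 + 1 :=
      fun j i hi => length_sweepAux_le _ _ _ hi
    have h1 := ex_sweep_fwd (onCell := dirCell star (if d.vert then .acc else .prv))
      (onRow := dirRow) (r := 8 * m + 12) (b := fun z => f z :: bs z)
      (b' := fun z => new z :: bs z) S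
      -- Going forward, the row marker precedes its cells, so at the marker the stacks are still
      -- those from the end of the row before; before the first row they are empty.
      (fun j => match j with
        | 0 => ([], [])
        | j + 1 => aux j (2 * N + 1)) aux
      (fun _ _ => rfl) hm (fun j => rfl)
      (fun j hj i hi S T hS h1 h2 => ex_dirCell
        (z := fun j i => ((i : ℤ) - N, (j : ℤ) - N))
        (fun j hj i hi => ⟨abs_le.2 (by simp only; omega), abs_le.2 (by simp only; omega)⟩)
        (fun j i => (Dir.pos_not_back hd j i).1) (fun j i => (Dir.pos_not_back hd j i).2)
        hnew hj hi hS h1 h2) (fun j hj S h1 h2 => ?_)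
    · have h2 := ex_pour (k := .rev) (y := .fwd) (S := { S with
        fwd := []
        rev := (grid N fun z => cellOf (new z :: bs z) (ns z)).reverse
        acc := (aux (2 * N) (2 * N + 1)).1
        prv := (aux (2 * N) (2 * N + 1)).2 }) (by decide) rfl
      have hc := sweep_cost (w := fun z => cellOf (new z :: bs z) (ns z)) (t := 8 * m + 12)
        (q := 4 * m + 12) (r := 8 * m + 12 + 4) hN hm' (by omega) (by omega) (by omega)
      have hl := hl (2 * N) (2 * N + 1) le_rfl
      unfold dirPass
      rw [hd]
      refine Ex.bind (Ex.bind h1 (h2.conv rfl) le_rfl)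
        (Ex.bind (ex_clear (l := (aux (2 * N) (2 * N + 1)).1) rfl)
          ((ex_clear (l := (aux (2 * N) (2 * N + 1)).2) rfl).conv ?_) le_rfl) ?_
      · simp
      · simp only [Store.get, List.length_reverse]
        omega
    · refine (ex_dirRow.mono ?_).conv ?_
      · rw [h1, h2]
        rcases j with _ | j
        · simp
        · have := hl j _ le_rfl
          simp only
          omega
      · rcases j with _ | j
        · rw [haux, sweepAux_zero, h1]; rfl
        · rw [haux, sweepAux_row, h1]
  · set aux := sweepAux d.vert (2 * N + 1) fun j i =>
      if star then new ((N : ℤ) - i, (N : ℤ) - j) else f ((N : ℤ) - i, (N : ℤ) - j) with haux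
    have hl : ∀ j i, i ≤ 2 * N + 1 →
        (aux j i).1.length ≤ 2 * N + 1 ∧ (aux j i).2.length ≤ 2 * N + 1 + 1 :=
      fun j i hi => length_sweepAux_le _ _ _ hi
    have h1 := ex_pour (k := .fwd) (y := .rev) (S := { S with
      fwd := grid N fun z => cellOf (f z :: bs z) (ns z), rev := [], acc := [], prv := [] })
      (by decide) rfl
    have h2 := ex_sweep_rev (onCell := dirCell star (if d.vert then .acc else .prv))
      (onRow := dirRow) (r := 8 * m + 12) (b := fun z => f z :: bs z)
      (b' := fun z => new z :: bs z) S aux hm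
      (fun j hj i hi S T hS h1 h2 => ex_dirCell
        (z := fun j i => ((N : ℤ) - i, (N : ℤ) - j))
        (fun j hj i hi => ⟨abs_le.2 (by simp only; omega), abs_le.2 (by simp only; omega)⟩)
        (fun j i => (Dir.pos_back hd j i).1) (fun j i => (Dir.pos_back hd j i).2)
        hnew hj hi hS h1 h2) (fun j _ S h1 h2 => ?_)
    · have hc := sweep_cost (w := fun z => cellOf (f z :: bs z) (ns z)) (t := 8 * m + 12)
        (q := 4 * m + 12) (r := 8 * m + 12 + 4) hN hm (by omega) (by omega) (by omega)
      have hl := hl (2 * N + 1) 0 (Nat.zero_le _)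
      unfold dirPass
      rw [hd]
      refine Ex.bind (Ex.bind (h1.conv ?_) h2 le_rfl)
        (Ex.bind (ex_clear (l := (aux (2 * N + 1) 0).1) rfl)
          ((ex_clear (l := (aux (2 * N + 1) 0).2) rfl).conv ?_) le_rfl) ?_
      · rw [haux, sweepAux_zero]
        simp
      · simp
      · simp only [Store.get]
        omega
    · refine (ex_dirRow.mono ?_).conv ?_
      · have := hl j _ le_rfl
        rw [h1, h2]
        omega
      · rw [haux, sweepAux_row, h1]

end

/-! ### Looking up names in the cells -/

/-- Compare the next symbol of a name with the name that is looked up. -/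
def compareBody (e : Bool) : Code (Bool ⊕ Bool) :=
  .bind (.pop .rev) fun s =>
    match s with
    | none => .ret (.inr false)
    | some s => .bind (.pop .nam) fun o =>
      seq (.push .fwd s) (seq
        (match o with
          | none => .ret ()
          | some w => .push .tmp w)
        (.ret (if s = .atom ∨ s = .here then .inr (e && o == some s) else .inl (e && o == some s))))

/-- Does a name in the grid agree with the name that is looked up? If so, make a mark on `prv`. -/
def closeCmd : Code Unit :=
  seq (.push .fwd .close) (.bind (.loop compareBody true) fun e =>
    seq (pour .tmp .nam) (if e then .push .prv .sep else .ret ()))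

/-- Write whether the name has been found in a cell. -/
def nameCell : Code Unit :=
  .bind (.pop .prv) fun o => seq (clear .prv) (seq (.push .fwd (.bit o.isSome)) (.push .fwd .cell))

/-- What to do with each symbol while a name is looked up. -/
def lookup : Sym → Code Unit
  | .cell => nameCell
  | .close => closeCmd
  | s => .push .fwd s

/-- Look up a name in all cells. -/
def namePass : Code (Option Sym) := seq (pour .fwd .rev) (each .rev lookup)

theorem ex_compare_step {e : Bool} {s : Sym} {l : List Sym} {S : Store} (h : S.rev = s :: l) :
    Ex (compareBody e) S 8
      (if s = .atom ∨ s = .here then .inr (e && S.nam.head? == some s)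
        else .inl (e && S.nam.head? == some s))
      { S with
        rev := l
        fwd := s :: S.fwd
        nam := S.nam.tail
        tmp := (S.nam.take 1).reverse ++ S.tmp } := by
  refine Ex.bind (t := 1) (t' := 7) (Ex.pop_cons h) ?_
  refine Ex.bind (t := 1) (t' := 6) Ex.pop ?_
  refine Ex.bind (t := 1) (t' := 5) Ex.push ?_
  refine Ex.bind (t := 1) (t' := 1) (a := ()) (S' := { S with
        rev := l
        fwd := s :: S.fwd
        nam := S.nam.tail
        tmp := (S.nam.take 1).reverse ++ S.tmp }) ?_ .ret
  simp only [Store.get, Store.set]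
  rcases hn : S.nam with _ | ⟨w, W⟩
  · exact Ex.ret.conv (by simp)
  · exact Ex.push

/-- The loop consumes as many symbols of `nam` as the grid name has and parks them on `tmp`, from
where they can be restored. It always reads the grid name to its end, also after a mismatch, so that
the name is copied completely. -/
theorem ex_compare (l : List Bool) (k : Bool) (rest : List Sym) (e : Bool) (S : Store)
    (h : S.rev = l.map Sym.bit ++ kindSym k :: rest) :
    Ex (.loop compareBody e) S (8 * (l.length + 1))
      (e && (l.map Sym.bit ++ [kindSym k]).isPrefixOf S.nam)
      { S with
        rev := rest
        fwd := kindSym k :: ((l.map Sym.bit).reverse ++ S.fwd)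
        nam := S.nam.drop (l.length + 1)
        tmp := (S.nam.take (l.length + 1)).reverse ++ S.tmp } := by
  induction l generalizing S e with
  | nil =>
    have h1 := ex_compare_step (e := e) (s := kindSym k) (l := rest) h
    rw [if_pos (by cases k <;> simp [kindSym])] at h1
    have h2 := Ex.loop_exit h1
    have e1 : (List.map Sym.bit [] ++ [kindSym k]).isPrefixOf S.nam =
        (S.nam.head? == some (kindSym k)) := by
      cases S.nam <;> simp [List.isPrefixOf, Bool.beq_comm]
    rw [e1]
    exact h2.conv (by simp)
  | cons b l ih =>
    have h1 := ex_compare_step (e := e) (s := .bit b) (l := l.map Sym.bit ++ kindSym k :: rest) h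
    rw [if_neg (by simp)] at h1
    have h2 := h1.steps.run (ih _ _ rfl)
    have e1 : (List.map Sym.bit (b :: l) ++ [kindSym k]).isPrefixOf S.nam =
        (S.nam.head? == some (.bit b) && (l.map Sym.bit ++ [kindSym k]).isPrefixOf S.nam.tail) := by
      cases S.nam <;> simp [List.isPrefixOf, Bool.beq_comm]
    rw [e1, ← Bool.and_assoc]
    refine (h2.conv ?_).mono (by rw [List.length_cons]; omega)
    cases S.nam <;> simp

/-- The kind symbol ends the reversed name and is not a digit, so these words form a prefix code,
and the prefix test is an equality test. -/
theorem isPrefixOf_name (l l' : List Bool) (k k' : Bool) :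
    (l.map Sym.bit ++ [kindSym k]).isPrefixOf (l'.map Sym.bit ++ [kindSym k']) =
      decide (l = l' ∧ k = k') := by
  induction l generalizing l' with
  | nil => cases l' <;> cases k <;> cases k' <;> simp [List.isPrefixOf, kindSym]
  | cons b l ih =>
    cases l' with
    | nil => cases k' <;> simp [List.isPrefixOf, kindSym]
    | cons b' l' =>
      simp only [List.map_cons, List.cons_append, List.isPrefixOf, ih, List.cons.injEq]
      by_cases hb : b = b' <;> simp [hb]

/-- The stack `nam` when the name `q` is looked up. -/
def target (q : Bool × List Bool) : List Sym := q.2.reverse.map Sym.bit ++ [kindSym q.1]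

theorem ex_close {q q' : Bool × List Bool} {rest : List Sym} {S : Store}
    (h : S.rev = q'.2.reverse.map Sym.bit ++ kindSym q'.1 :: rest) (hn : S.nam = target q)
    (ht : S.tmp = []) :
    Ex closeCmd S (12 * q'.2.length + 20) () { S with
      rev := rest
      fwd := nameWord q' ++ S.fwd
      prv := if q' = q then .sep :: S.prv else S.prv } := by
  refine Ex.bind (t := 1) (t' := 12 * q'.2.length + 19) Ex.push ?_
  have h1 := ex_compare _ _ _ true { S with fwd := .close :: S.fwd } h
  have h2 : (List.map Sym.bit q'.2.reverse ++ [kindSym q'.1]).isPrefixOf S.nam =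
      decide (q' = q) := by
    rw [hn, target, isPrefixOf_name]
    simp [Prod.ext_iff, and_comm]
  rw [Bool.true_and, h2] at h1
  have h3 := ex_pour (k := .tmp) (y := .nam) (S := { S with
    rev := rest
    fwd := kindSym q'.1 :: ((List.map Sym.bit q'.2.reverse).reverse ++ .close :: S.fwd)
    nam := S.nam.drop (q'.2.reverse.length + 1)
    tmp := (S.nam.take (q'.2.reverse.length + 1)).reverse ++ S.tmp }) (by decide) rfl
  have h4 := h3.conv (S'' := { S with rev := rest, fwd := nameWord q' ++ S.fwd })
    (by ext1 <;> simp [ht, nameWord])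
  refine Ex.bind h1 (Ex.bind (t' := 1) h4 ?_ le_rfl) ?_
  · by_cases hq : q' = q
    · simp only [hq, decide_true, if_true]
      exact Ex.push
    · simp only [hq, decide_false, if_false]
      exact Ex.ret
  · simp only [Store.get, ht, List.append_nil, List.length_reverse, List.length_take]
    omega

/-- The induction removes names from the right because the reversed scan meets the last one first.
Each occurrence of `q` leaves one mark on `prv`; only whether there is any mark will matter. -/
theorem steps_names {q : Bool × List Bool} {rest : List Sym} (ns : List (Bool × List Bool))
    (S : Store) (h : S.rev = (ns.flatMap nameWord).reverse ++ rest) (hn : S.nam = target q)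
    (ht : S.tmp = []) :
    Steps (scanBody .rev (fun _ => false) lookup) S () (12 * (ns.flatMap nameWord).length)
      { S with
        rev := rest
        fwd := ns.flatMap nameWord ++ S.fwd
        prv := List.replicate (ns.count q) .sep ++ S.prv } () := by
  induction ns using List.reverseRecOn generalizing S with
  | nil => exact Steps.refl.conv (by ext1 <;> simp_all)
  | append_singleton ns q' ih =>
    have e : S.rev = Sym.close :: (q'.2.reverse.map Sym.bit ++
        kindSym q'.1 :: ((ns.flatMap nameWord).reverse ++ rest)) := by
      rw [h]; simp [nameWord]
    have h1 := Ex.scan_step (k := .rev) (halt := fun _ => false) (h := lookup) (a := ()) e rfl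
      (ex_close (q := q) (q' := q') (S := { S with rev := _ }) rfl hn ht)
    have h2 := ih { S with
      rev := (ns.flatMap nameWord).reverse ++ rest
      fwd := nameWord q' ++ S.fwd
      prv := if q' = q then .sep :: S.prv else S.prv } rfl hn ht
    refine ((h1.trans h2).conv ?_).mono ?_
    · by_cases hq : q' = q
      · subst hq
        simp [List.replicate_add]
      · simp [hq]
    · simp [nameWord]
      omega

theorem ex_nameCell {S : Store} : Ex nameCell S (4 * S.prv.length + 6) () { S with
    fwd := .cell :: .bit (decide (S.prv ≠ [])) :: S.fwd
    prv := [] } := by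
  refine Ex.bind (t := 1) Ex.pop (Ex.bind (ex_clear rfl)
    (Ex.bind (t := 1) (t' := 1) Ex.push (Ex.push.conv ?_) le_rfl) le_rfl) ?_
  · ext1 <;> simp
    cases S.prv <;> simp
  · simp
    omega

theorem ex_namePass {N m : ℕ} {bs : ℤ × ℤ → List Bool} {ns : ℤ × ℤ → List (Bool × List Bool)}
    (q : Bool × List Bool) (S : Store) (hN : 2 * N + 1 ≤ m)
    (hm : ∀ z, InBox N z → (cellOf (bs z) (ns z)).length ≤ m)
    (hn : S.nam = target q) (ht : S.tmp = []) :
    Ex namePass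
      { S with fwd := grid N fun z => cellOf (bs z) (ns z), rev := [], acc := [], prv := [] }
      (100 * m ^ 3) none
      { S with
        fwd := grid N fun z => cellOf (decide (q ∈ ns z) :: bs z) (ns z)
        rev := [], acc := [], prv := [] } := by
  have h1 := ex_pour (k := .fwd) (y := .rev) (S := { S with
      fwd := grid N fun z => cellOf (bs z) (ns z), rev := [], acc := [], prv := [] })
      (by decide) rfl
  have h2 := Steps.grid_rev (f := scanBody .rev (fun _ => false) lookup)
    (a := ()) (fun src dst (_ : Unit) =>
      { S with rev := src, fwd := dst, acc := [], prv := [] }) N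
    (fun z => cellOf (bs z) (ns z)) (fun z => cellOf (decide (q ∈ ns z) :: bs z) (ns z))
    (fun _ => ()) (fun _ _ => ()) (16 * m + 10) 4 (fun _ => rfl) (fun j hj src dst => ?_)
    (fun j hj i hi src dst => ?_)
  · have hc := sweep_cost (w := fun z => cellOf (bs z) (ns z)) (t := 4)
      (q := 16 * m + 10) (r := 4) hN hm (by omega) (by omega) (by omega)
    refine Ex.bind (h1.conv ?_) (h2.run (Ex.scan_nil rfl)) ?_
    · simp
    · simp only [Store.get]
      omega
  · exact Ex.scan_step (s := .row) (l := src) (a := ()) rfl rfl Ex.push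
  · have hz : InBox N ((N : ℤ) - i, (N : ℤ) - j) :=
      ⟨abs_le.2 (by simp only; omega), abs_le.2 (by simp only; omega)⟩
    have hlen := hm _ hz
    generalize ((N : ℤ) - i, (N : ℤ) - j) = z at hz hlen ⊢
    have e1 := steps_names (q := q) (rest := ((bs z).map Sym.bit).reverse ++ .cell :: src) (ns z)
      { S with
        rev := ((ns z).flatMap nameWord).reverse ++
          (((bs z).map Sym.bit).reverse ++ .cell :: src)
        fwd := dst, acc := [], prv := [] } rfl hn ht
    have e2 := Steps.copy (k := .rev) (y := .fwd) (halt := fun _ => false)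
      (h := lookup) (l := ((bs z).map Sym.bit).reverse) (r := .cell :: src) (S := { S with
        rev := ((bs z).map Sym.bit).reverse ++ .cell :: src
        fwd := (ns z).flatMap nameWord ++ dst
        acc := []
        prv := List.replicate ((ns z).count q) .sep })
      (by decide) rfl (fun _ _ => rfl) (fun s hs => by
        simp only [List.mem_reverse, List.mem_map] at hs
        obtain ⟨b, _, rfl⟩ := hs
        rfl)
    have e3 := Ex.scan_step (k := .rev) (halt := fun _ => false) (h := lookup) (s := .cell)
      (l := src) (a := ()) (S := { S with
        rev := .cell :: src
        fwd := (bs z).map Sym.bit ++ ((ns z).flatMap nameWord ++ dst)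
        acc := []
        prv := List.replicate ((ns z).count q) .sep }) rfl rfl ex_nameCell
    simp only [Store.set, List.length_replicate] at e3
    have hcount : (ns z).count q ≤ ((ns z).flatMap nameWord).length := by
      refine List.count_le_length.trans ?_
      rw [List.length_flatMap]
      refine le_of_eq_of_le ?_ (List.length_le_sum_of_one_le _ fun i hi => ?_)
      · rw [List.length_map]
      · obtain ⟨q, _, rfl⟩ := List.mem_map.1 hi
        simp [nameWord]
    refine Steps.mono (t := 12 * ((ns z).flatMap nameWord).length +
      (4 * ((bs z).map Sym.bit).reverse.length + (4 * (ns z).count q + 6 + 3))) ?_ ?_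
    · have e0 : (cellOf (bs z) (ns z)).reverse ++ src = ((ns z).flatMap nameWord).reverse ++
          (((bs z).map Sym.bit).reverse ++ .cell :: src) := by simp [cellOf]
      rw [e0]
      refine (e1.conv ?_).trans ((e2.conv ?_).trans (e3.conv ?_))
      · simp
      · simp
      · simp [cellOf, List.replicate_eq_nil_iff, List.count_eq_zero]
    · simp only [cellOf, List.length_cons, List.length_append, List.length_reverse] at hlen ⊢
      omega

/-! ### Evaluating the formula on the grid -/

/-- Negate the first value in a cell. -/
def negCell : Code Unit :=
  .bind (.pop .fwd) fun s => .push .fwd (.bit (!(readBit s).getD false))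

/-- Replace the first two values in a cell by their conjunction. -/
def andCell : Code Unit :=
  .bind (.pop .fwd) fun s => .bind (.pop .fwd) fun s' =>
    .push .fwd (.bit ((readBit s).getD false && (readBit s').getD false))

/-- Is this the first symbol of a name? -/
def isKind (s : Sym) : Bool := decide (s = .atom ∨ s = .here)

/-- Look up the name that ends the formula stack. -/
def evalName : Code Unit :=
  .bind (move .frm .tmp isKind) fun s =>
    seq (.push .nam (s.getD .atom)) (seq (pour .tmp .nam) (seq namePass (seq (clear .nam) (.ret ()))))

/-- Update the grid for one symbol of the formula. -/
def evalTok : Sym → Code Unit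
  | .neg => seq (localPass negCell) (.ret ())
  | .and => seq (localPass andCell) (.ret ())
  | .box (.step d) => seq (dirPass false d) (.ret ())
  | .box (.star d) => seq (dirPass true d) (.ret ())
  | .close => evalName
  | _ => .ret ()

theorem ex_negCell {b : Bool} {S : Store} {T : List Sym} (h : S.fwd = .bit b :: T) :
    Ex negCell S 8 () { S with fwd := .bit (!b) :: T } :=
  Ex.bind (t := 1) (t' := 1) (Ex.pop_cons h) Ex.push

theorem ex_andCell {b b' : Bool} {S : Store} {T : List Sym} (h : S.fwd = .bit b :: .bit b' :: T) :
    Ex andCell S 8 () { S with fwd := .bit (b && b') :: T } := by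
  refine Ex.bind (t := 1) (t' := 2) (Ex.pop_cons h) ?_
  exact Ex.bind (t := 1) (t' := 1) (Ex.pop_cons rfl) Ex.push

section

variable {Atm Agt : Type}

theorem sat_star_of_stable {M : SpatialModel Atm Agt} {φ : Formula Atm Agt} {d : Dir} {N : ℤ}
    (h : StableFrom (Sat M φ) d N) {z : ℤ × ℤ} (hz : N ≤ d.coord z) :
    Sat M (.box (.star d) φ) z ↔ Sat M φ z := by
  rw [sat_star]
  have key : ∀ k, N ≤ d.coord (d.move^[k] z) ∧ (Sat M φ (d.move^[k] z) ↔ Sat M φ z) := by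
    intro k
    induction k with
    | zero => exact ⟨hz, Iff.rfl⟩
    | succ k ih =>
      rw [Function.iterate_succ_apply', Dir.coord_move_self]
      exact ⟨by omega, (h _ ih.1).trans ih.2⟩
  exact ⟨fun h => h 0, fun h k => (key k).2.2 h⟩

open Classical in
-- These are the recurrences required by `ex_dirPass`. Beyond `N` truth is constant along `d`, so at
-- the border `[d]φ` and `[d*]φ` both have the value of φ, which is what the defaults in `combine`
-- produce.
theorem combine_sat {M : SpatialModel Atm Agt} {φ : Formula Atm Agt} {d : Dir} {N : ℤ}
    (h : StableFrom (Sat M φ) d N) (z : ℤ × ℤ) :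
    decide (Sat M (.box (.step d) φ) z) = combine false (if d.coord z < N then
      some (decide (Sat M φ (d.move z))) else none) (decide (Sat M φ z)) ∧
    decide (Sat M (.box (.star d) φ) z) = combine true (if d.coord z < N then
      some (decide (Sat M (.box (.star d) φ) (d.move z))) else none) (decide (Sat M φ z)) := by
  by_cases hz : d.coord z < N
  · simp only [if_pos hz, combine, Option.getD_some, if_true, Bool.false_eq_true, if_false]
    refine ⟨by rw [decide_eq_decide, sat_step], ?_⟩
    rw [← Bool.decide_and, decide_eq_decide, sat_star_move, and_comm]
  · simp only [if_neg hz, combine, Option.getD_none, if_true, Bool.false_eq_true, if_false,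
      Bool.true_and, decide_eq_decide]
    exact ⟨by rw [sat_step, h z (by omega)], sat_star_of_stable h (by omega)⟩

end

section

variable {Atm : Type} [Encodable Atm] {m : ℕ}

/-- The stacks while the formula is evaluated. -/
abbrev stage (inp cnt frm fwd : List Sym) : Store :=
  { inp := inp, cnt := cnt, frm := frm, fwd := fwd }

variable {N l : ℕ} {ns : ℤ × ℤ → List (Bool × List Bool)} {inp cnt : List Sym}

/-- The digits arrive reversed from the formula stack. Passing through `tmp`, they are reversed
twice and end above the kind symbol on `nam`, in the order in which the reversed grid presents
names. -/
theorem ex_evalName (q : Bool × List Bool) (rest : List Sym) (bs : ℤ × ℤ → List Bool)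
    (hN : 2 * N + 1 ≤ l) (hl : ∀ z, InBox N z → (cellOf (bs z) (ns z)).length ≤ l)
    (hq : (nameWord q).length ≤ l) :
    Ex evalName
      (stage inp cnt (q.2.reverse.map Sym.bit ++ kindSym q.1 :: rest)
        (grid N fun z => cellOf (bs z) (ns z)))
      (100 * l ^ 3 + 12 * l + 10) ()
      (stage inp cnt rest (grid N fun z => cellOf (decide (q ∈ ns z) :: bs z) (ns z))) := by
  have hq' : q.2.length + 1 < l := by simpa [nameWord] using hq
  have h1 := ex_move (k := .frm) (y := .tmp) (halt := isKind)
    (S := stage inp cnt (q.2.reverse.map Sym.bit ++ kindSym q.1 :: rest)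
        (grid N fun z => cellOf (bs z) (ns z))) (by decide) rfl
    (fun s hs => by
      obtain ⟨b, _, rfl⟩ := List.mem_map.1 hs
      simp [isKind]) (by cases q.1 <;> simp [isKind, kindSym])
  have h2 : Ex (pour .tmp .nam)
      { inp := inp, cnt := cnt, frm := rest, fwd := grid N fun z => cellOf (bs z) (ns z)
        tmp := q.2.map Sym.bit, nam := [kindSym q.1] } _ none
      { inp := inp, cnt := cnt, frm := rest, fwd := grid N fun z => cellOf (bs z) (ns z)
        nam := target q } :=
    (ex_pour (k := .tmp) (y := .nam) (l := q.2.map Sym.bit) (by decide) rfl).conv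
      (by simp [target])
  have h3 := ex_namePass q { inp := inp, cnt := cnt, frm := rest, nam := target q } hN hl rfl rfl
  have h4 := ex_clear (k := .nam) (l := target q)
    (S := { inp := inp, cnt := cnt, frm := rest, nam := target q
            fwd := grid N fun z => cellOf (decide (q ∈ ns z) :: bs z) (ns z) }) rfl
  have h1' := h1.conv (S'' := { inp := inp, cnt := cnt, frm := rest
                                fwd := grid N fun z => cellOf (bs z) (ns z)
                                tmp := q.2.map Sym.bit }) (by simp)
  refine Ex.bind h1' (Ex.bind (t := 1) Ex.push (Ex.bind h2 (Ex.bind h3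
    (Ex.bind h4 .ret le_rfl) le_rfl) le_rfl) le_rfl) ?_
  simp only [target, List.length_append, List.length_map, List.length_reverse, List.length_singleton]
  omega

open Classical in
-- Read from its end, a prefix formula is a postfix program whose net effect is to push one value in
-- every cell. Arbitrary `rest` and `bs` allow subformulas to be run in context. The hypothesis `hl`
-- reserves room in each cell for one value per symbol, which bounds the cell length throughout the
-- evaluation.
theorem steps_eval {M : SpatialModel Atm (Fin m)} {n : ℕ} (hM : M.Bounded n)
    (hatom : ∀ z, InBox N z → ∀ p, (false, (Encodable.encode p).bits) ∈ ns z ↔ p ∈ M.V z)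
    (hhere : ∀ z, InBox N z → ∀ i : Fin m, (true, (i : ℕ).bits) ∈ ns z ↔ M.P i = z)
    (hN : 2 * N + 1 ≤ l) (φ : Formula Atm (Fin m)) (rest : List Sym) (bs : ℤ × ℤ → List Bool)
    (hφ : n + (formulaWord φ).length ≤ N)
    (hl : ∀ z, InBox N z → (cellOf (bs z) (ns z)).length + (formulaWord φ).length ≤ l) :
    Steps (scanBody .frm (fun _ => false) evalTok)
      (stage inp cnt ((formulaWord φ).reverse ++ rest) (grid N fun z => cellOf (bs z) (ns z))) ()
      ((formulaWord φ).length * (140 * l ^ 3))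
      (stage inp cnt rest (grid N fun z => cellOf (decide (Sat M φ z) :: bs z) (ns z))) () := by
  have hpow : l ≤ l ^ 3 := Nat.le_self_pow (by norm_num) l
  have hcell : ∀ (b : Bool) (bs : List Bool) (ns), (cellOf (b :: bs) ns).length =
      (cellOf bs ns).length + 1 := fun b bs ns => by simp [cellOf]
  -- A witness that the square is nonempty, used to extract a bound on the length of a name from
  -- `hl`.
  have hO : InBox N (0, 0) := by simp [InBox]
  induction φ generalizing rest bs with
  | atom p =>
    have h1 := ex_evalName (ns := ns) (inp := inp) (cnt := cnt) (false, (Encodable.encode p).bits) rest bs hN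
      (fun z hz => by have := hl z hz; omega)
      (by have := hl _ hO; simp only [formulaWord, atomWord, natWord, nameWord,
            List.length_cons] at this ⊢; omega)
    have h2 := Ex.scan_step (k := .frm) (halt := fun _ => false) (h := evalTok) (s := .close)
      (S := stage inp cnt ((formulaWord (m := m) (.atom p)).reverse ++ rest)
        (grid N fun z => cellOf (bs z) (ns z))) (a := ())
      (by simp [formulaWord, atomWord, natWord]; rfl) rfl h1
    refine (h2.conv ?_).mono ?_
    · congr 1
      refine grid_congr fun z hz => ?_
      exact congrArg (fun b => cellOf (b :: bs z) (ns z)) (decide_eq_decide.2 (hatom z hz p))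
    · have := formulaWord_length_pos (m := m) (.atom p)
      nlinarith
  | here i =>
    have h1 := ex_evalName (ns := ns) (inp := inp) (cnt := cnt) (true, (i : ℕ).bits) rest bs hN
      (fun z hz => by have := hl z hz; omega)
      (by have := hl _ hO; simp only [formulaWord, hereWord, natWord, nameWord,
            List.length_cons] at this ⊢; omega)
    have h2 := Ex.scan_step (k := .frm) (halt := fun _ => false) (h := evalTok) (s := .close)
      (S := stage inp cnt ((formulaWord (Atm := Atm) (.here i)).reverse ++ rest)
        (grid N fun z => cellOf (bs z) (ns z))) (a := ())
      (by simp [formulaWord, hereWord, natWord]; rfl) rfl h1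
    refine (h2.conv ?_).mono ?_
    · congr 1
      refine grid_congr fun z hz => ?_
      exact congrArg (fun b => cellOf (b :: bs z) (ns z)) (decide_eq_decide.2 (hhere z hz i))
    · have := formulaWord_length_pos (Atm := Atm) (.here i)
      nlinarith
  | neg φ ih =>
    simp only [formulaWord, List.length_cons] at hφ hl ⊢
    have h1 := ih (.neg :: rest) bs (by omega) (fun z hz => by have := hl z hz; omega)
    have h2 := ex_localPass (onCell := negCell) (m := l) (ns := ns)
      (b := fun z => decide (Sat M φ z) :: bs z)
      (b' := fun z => decide (Sat M (.neg φ) z) :: bs z) { inp := inp, cnt := cnt, frm := rest }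
      (fun z hz => by have := hl z hz; rw [hcell]; omega) hN
      (fun z _ S T h => by
        have e : decide (Sat M (.neg φ) z) = !decide (Sat M φ z) := by
          by_cases h : Sat M φ z <;> simp [Sat, h]
        rw [e]
        exact ex_negCell h)
    have h3 := Ex.scan_step (k := .frm) (halt := fun _ => false) (h := evalTok) (s := .neg)
      (S := stage inp cnt (.neg :: rest)
        (grid N fun z => cellOf (decide (Sat M φ z) :: bs z) (ns z))) (a := ()) (t := 100 * l ^ 3 + 1)
      rfl rfl (Ex.bind h2 .ret)
    rw [List.reverse_cons, List.append_assoc]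
    refine (h1.trans h3).mono ?_
    rw [add_mul]
    omega
  | and φ ψ ih1 ih2 =>
    simp only [formulaWord, List.length_cons, List.length_append] at hφ hl ⊢
    have hφ0 := formulaWord_length_pos φ
    have hψ0 := formulaWord_length_pos ψ
    -- Reading backwards meets ψ first, so the value of φ ends up above that of ψ.
    have h1 := ih2 ((formulaWord φ).reverse ++ .and :: rest) bs (by omega)
      (fun z hz => by have := hl z hz; omega)
    have h1' := ih1 (.and :: rest) (fun z => decide (Sat M ψ z) :: bs z) (by omega)
      (fun z hz => by have := hl z hz; rw [hcell]; omega)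
    have h2 := ex_localPass (onCell := andCell) (m := l) (ns := ns)
      (b := fun z => decide (Sat M φ z) :: decide (Sat M ψ z) :: bs z)
      (b' := fun z => decide (Sat M (.and φ ψ) z) :: bs z)
      { inp := inp, cnt := cnt, frm := rest }
      (fun z hz => by have := hl z hz; rw [hcell, hcell]; omega) hN
      (fun z _ S T h => by
        have e : decide (Sat M (.and φ ψ) z) = (decide (Sat M φ z) && decide (Sat M ψ z)) := by
          by_cases h : Sat M φ z <;> by_cases h' : Sat M ψ z <;> simp [Sat, h, h']
        rw [e]
        exact ex_andCell h)
    have h3 := Ex.scan_step (k := .frm) (halt := fun _ => false) (h := evalTok) (s := .and)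
      (S := stage inp cnt (.and :: rest)
        (grid N fun z => cellOf (decide (Sat M φ z) :: decide (Sat M ψ z) :: bs z) (ns z)))
      (a := ()) (t := 100 * l ^ 3 + 1) rfl rfl (Ex.bind h2 .ret)
    rw [List.reverse_cons, List.reverse_append, List.append_assoc, List.append_assoc]
    refine (h1.trans (h1'.trans h3)).mono ?_
    rw [add_mul, add_mul]
    omega
  | box α φ ih =>
    simp only [formulaWord, List.length_cons] at hφ hl ⊢
    have h1 := ih (.box α :: rest) bs (by omega) (fun z hz => by have := hl z hz; omega)
    -- The padding makes the border coordinate `N` at least the stability threshold of the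
    -- subformula.
    have hst : ∀ d, StableFrom (Sat M φ) d N := fun d z hz =>
      stableFrom_sat hM φ d z (by omega)
    have h2 : Ex (evalTok (.box α)) (stage inp cnt rest
        (grid N fun z => cellOf (decide (Sat M φ z) :: bs z) (ns z))) (100 * l ^ 3 + 1) ()
        (stage inp cnt rest
          (grid N fun z => cellOf (decide (Sat M (.box α φ) z) :: bs z) (ns z))) := by
      cases α with
      | step d =>
        exact Ex.bind (ex_dirPass (star := false) (m := l)
          (f := fun z => decide (Sat M φ z)) (new := fun z => decide (Sat M (.box (.step d) φ) z))
          { inp := inp, cnt := cnt, frm := rest } hN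
          (fun z hz => by have := hl z hz; rw [hcell]; omega)
          (fun z _ => (combine_sat (hst d) z).1)) .ret
      | star d =>
        exact Ex.bind (ex_dirPass (star := true) (m := l)
          (f := fun z => decide (Sat M φ z)) (new := fun z => decide (Sat M (.box (.star d) φ) z))
          { inp := inp, cnt := cnt, frm := rest } hN
          (fun z hz => by have := hl z hz; rw [hcell]; omega)
          (fun z _ => (combine_sat (hst d) z).2)) .ret
    have h3 := Ex.scan_step (k := .frm) (halt := fun _ => false) (h := evalTok) (s := .box α)
      (S := stage inp cnt (.box α :: rest)
        (grid N fun z => cellOf (decide (Sat M φ z) :: bs z) (ns z))) (a := ()) rfl rfl h2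
    rw [List.reverse_cons, List.append_assoc]
    refine (h1.trans h3).mono ?_
    rw [add_mul]
    omega

end

/-! ### Reading the instance and padding the grid -/

/-- Run `c` once for each symbol of the stack `k`, which is preserved with the help of the stack
`t`. -/
def rep {α : Type} [Finite α] (k t : Stk) (c : Code α) : Code (Option Sym) :=
  seq (each k fun a => seq (Cmd.push t a) c) (pour t k)

/-- During the iteration the counter is split between `k` and `t`, so `c` must work for any contents
`r`, `r'` of these two stacks. -/
theorem ex_rep {α : Type} [Finite α] {k t : Stk} {c : Code α} {a : α} (hkt : k ≠ t)
    (St : ℕ → Store) (l : List Sym) (q : ℕ)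
    (h : ∀ i < l.length, ∀ r r', Ex c (((St i).set k r).set t r') q a
      (((St (i + 1)).set k r).set t r')) :
    Ex (rep k t c) (((St 0).set k l).set t []) (l.length * (q + 9) + 9) none
      (((St l.length).set k l).set t []) := by
  have main : ∀ (l₂ l₁ : List Sym), l₁.length + l₂.length = l.length →
      Ex (each k fun a => seq (Cmd.push t a) c) (((St l₁.length).set k l₂).set t l₁.reverse)
        (l₂.length * (q + 5) + 2) none
        (((St l.length).set k []).set t (l₁ ++ l₂).reverse) := by
    intro l₂
    induction l₂ with
    | nil =>
      intro l₁ hl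
      rw [List.length_nil, add_zero] at hl
      rw [hl, List.append_nil]
      exact (Ex.scan_nil (by rw [Store.get_set_of_ne _ hkt, Store.get_set])).mono (by omega)
    | cons s l₂ ih =>
      intro l₁ hl
      rw [List.length_cons] at hl
      have h1 := Ex.push (S := ((St l₁.length).set k l₂).set t l₁.reverse) (k := t) (s := s)
      rw [Store.get_set, Store.set_set] at h1
      have h2 := Ex.scan_step (k := k) (halt := fun _ => false)
        (h := fun a => seq (Cmd.push t a) c) (s := s) (l := l₂)
        (S := ((St l₁.length).set k (s :: l₂)).set t l₁.reverse)
        (by rw [Store.get_set_of_ne _ hkt, Store.get_set]) rfl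
        (by
          rw [Store.set_comm _ hkt, Store.set_set]
          exact Ex.bind h1 (h l₁.length (by omega) _ _) le_rfl)
      have h3 := ih (l₁ ++ [s]) (by rw [List.length_append, List.length_singleton]; omega)
      rw [List.reverse_append, List.append_assoc, List.length_append] at h3
      exact (h2.run h3).mono (by rw [List.length_cons]; lia)
  have h1 := main l [] (by simp)
  have h2 := ex_pour (k := t) (y := k) (S := ((St l.length).set k []).set t ([] ++ l).reverse)
    hkt (Store.get_set ..)
  refine Ex.bind h1 (h2.conv ?_) ?_
  · rw [Store.get_set_of_ne _ hkt, Store.get_set, List.append_nil,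
      List.reverse_reverse, List.nil_append, Store.set_set, Store.set_comm _ hkt, Store.set_set]
  · simp only [List.nil_append, List.length_reverse]
    lia

theorem range_flatMap_pad {α : Type} (k M : ℕ) (g : ℕ → List α) (p : List α)
    (h1 : ∀ i < k, g i = p) (h2 : ∀ i < k, g (k + M + i) = p) :
    (List.range (k + M + k)).flatMap g =
      (List.replicate k p).flatten ++ (List.range M).flatMap (fun i => g (k + i)) ++
        (List.replicate k p).flatten := by
  have e : ∀ g : ℕ → List α, (∀ i < k, g i = p) →
      (List.range k).flatMap g = (List.replicate k p).flatten := by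
    intro g h
    rw [List.flatMap_congr (g := fun _ => p) (fun i hi => h i (List.mem_range.1 hi)),
      List.flatMap_def, List.map_const', List.length_range]
  rw [List.range_add, List.flatMap_append, List.range_add, List.flatMap_append, e g h1,
    List.flatMap_map, List.flatMap_map, e _ h2]

/-- A row of the grid of side `2 * n + 1`, with `k` more cells at both ends. -/
def padRow (n k : ℕ) (w : ℤ × ℤ → List Sym) (j : ℕ) : List Sym :=
  .row :: (List.replicate k .cell ++
    (List.range (2 * n + 1)).flatMap (fun (i : ℕ) => w ((i : ℤ) - n, (j : ℤ) - n)))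

/-- Cells outside the original square contain no names, so enlarging the square adds only empty
cells around each row and empty rows at both ends. -/
theorem grid_pad (n k : ℕ) (w : ℤ × ℤ → List Sym)
    (hw : ∀ z, InBox (n + k) z → ¬ InBox n z → w z = [.cell]) :
    grid (n + k) w =
      (List.replicate k (Sym.row :: List.replicate (2 * (n + k) + 1) .cell)).flatten ++
      (List.range (2 * n + 1)).flatMap (fun j => padRow n k w j ++ List.replicate k .cell) ++
      (List.replicate k (Sym.row :: List.replicate (2 * (n + k) + 1) .cell)).flatten := by
  have e : 2 * (n + k) + 1 = k + (2 * n + 1) + k := by omega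
  have hflat : ∀ k, (List.replicate k [Sym.cell]).flatten = List.replicate k Sym.cell := by
    intro k
    induction k with
    | zero => rfl
    | succ k ih => rw [List.replicate_succ, List.flatten_cons, ih]; rfl
  have hout : ∀ x y : ℤ, |x| ≤ n + k → |y| ≤ n + k → (n < |x| ∨ n < |y|) → w (x, y) = [.cell] := by
    intro x y hx hy h
    refine hw _ ⟨by push_cast; exact hx, by push_cast; exact hy⟩ fun hz => ?_
    have h1 := hz.1
    have h2 := hz.2
    simp only at h1 h2
    omega
  have blank : ∀ j < k + (2 * n + 1) + k, j < k ∨ k + (2 * n + 1) ≤ j →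
      (Sym.row :: (List.range (2 * (n + k) + 1)).flatMap fun (i : ℕ) =>
        w ((i : ℤ) - (n + k : ℕ), (j : ℤ) - (n + k : ℕ))) =
      Sym.row :: List.replicate (2 * (n + k) + 1) .cell := by
    intro j hj hj'
    congr 1
    rw [← hflat, List.flatMap_congr (g := fun _ => [Sym.cell]) (fun i hi => ?_),
      List.flatMap_def, List.map_const', List.length_range]
    rw [List.mem_range] at hi
    push_cast
    exact hout _ _ (abs_le.2 (by omega)) (abs_le.2 (by omega)) (.inr (lt_abs.2 (by omega)))
  unfold grid
  conv_lhs => rw [e]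
  rw [range_flatMap_pad k (2 * n + 1) _ (Sym.row :: List.replicate (2 * (n + k) + 1) .cell)]
  · congr 2
    refine List.flatMap_congr fun j hj => ?_
    rw [List.mem_range] at hj
    rw [padRow, List.cons_append]
    congr 1
    rw [range_flatMap_pad k (2 * n + 1) _ [Sym.cell], hflat]
    · congr 2
      refine List.flatMap_congr fun i hi => ?_
      congr 2 <;> push_cast <;> ring
    · intro i hi
      push_cast
      exact hout _ _ (abs_le.2 (by omega)) (abs_le.2 (by omega)) (.inl (lt_abs.2 (by omega)))
    · intro i hi
      push_cast
      exact hout _ _ (abs_le.2 (by omega)) (abs_le.2 (by omega)) (.inl (lt_abs.2 (by omega)))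
  · intro j hj
    rw [← e]
    exact blank j (by omega) (.inl hj)
  · intro j hj
    rw [← e]
    exact blank _ (by omega) (.inr (by omega))

/-- The end of a row is noticed only at the next row marker, where the right padding of one row is
written together with the left padding of the next. This regroups the word accordingly. -/
theorem flatMap_range_succ_append {α : Type} (x : ℕ → List α) (p : List α) (L : ℕ) :
    (List.range (L + 1)).flatMap (fun j => x j ++ p) =
      x 0 ++ (List.range L).flatMap (fun j => p ++ x (j + 1)) ++ p := by
  induction L with
  | zero => simp
  | succ L ih =>
    rw [List.range_succ, List.flatMap_append, ih, List.range_succ, List.flatMap_append]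
    simp

/-- Copy a symbol of the grid, and pad the rows with as many empty cells as there are symbols in
the formula. -/
def padSym : Sym → Code Unit
  | .row => seq (fill .frm .tmp .rev .cell)
      (seq (.push .rev .row) (seq (fill .frm .tmp .rev .cell) (.push .cnt .sep)))
  | s => .push .rev s

/-- Read the formula and the grid, which is padded by empty rows and columns. -/
def prepare : Code (Option Sym) :=
  seq (move .inp .frm fun s => decide (s = .sep)) <|
  seq (scan .inp (fun s => decide (s = .close)) fun _ => .ret ()) <|
  seq (.pop .inp) <| seq (.push .rev .row) <| seq (fill .frm .tmp .rev .cell) <|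
  seq (.push .cnt .sep) <| seq (scan .inp (fun s => decide (s = .sep)) padSym) <|
  seq (fill .frm .tmp .rev .cell) <| seq (fill .frm .tmp .cnt .sep) <|
  seq (fill .frm .tmp .cnt .sep) <|
  seq (rep .frm .tmp (seq (.push .rev .row) (fill .cnt .prv .rev .cell))) <|
  seq (pour .rev .fwd) <| rep .frm .tmp (seq (fill .cnt .prv .fwd .cell) (.push .fwd .row))

theorem padSym_eq {s : Sym} (h : s ≠ .row) : padSym s = .push .rev s := by
  cases s <;> first | rfl | contradiction

theorem length_padRow_le {n k l : ℕ} {w : ℤ × ℤ → List Sym}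
    (hcell : ∀ z, InBox n z → (w z).length ≤ l) (hl : 2 * (n + k) + 1 ≤ l) {j : ℕ}
    (hj : j < 2 * n + 1) :
    (padRow n k w j ++ List.replicate k Sym.cell).length ≤ l * l + l := by
  have h1 : ((List.range (2 * n + 1)).flatMap
      (fun (i : ℕ) => w ((i : ℤ) - n, (j : ℤ) - n))).length ≤ (2 * n + 1) * l :=
    length_flatMap_range_le fun i hi => hcell _
      ⟨abs_le.2 (by simp only; omega), abs_le.2 (by simp only; omega)⟩
  have h2 : (2 * n + 1) * l ≤ l * l := Nat.mul_le_mul_right _ (by omega)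
  simp only [padRow, List.length_append, List.length_cons, List.length_replicate]
  omega

/-- Reading one row of the grid, after the symbols of the row before. -/
theorem steps_padRow {n k : ℕ} {w : ℤ × ℤ → List Sym} {S : Store} {j : ℕ} {src : List Sym}
    (hk : S.frm.length = k) (ht : S.tmp = [])
    (hmem : ∀ z, InBox n z → ∀ s ∈ w z, s ≠ .row ∧ s ≠ .sep) (hj : j < 2 * n + 1)
    (h : S.inp = .row :: ((List.range (2 * n + 1)).flatMap
      (fun (i : ℕ) => w ((i : ℤ) - n, (j : ℤ) - n)) ++ src)) :
    Steps (scanBody .inp (fun s => decide (s = .sep)) padSym) S ()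
      (18 * k + 15 + 4 * (padRow n k w j ++ List.replicate k Sym.cell).length)
      { S with
        inp := src
        rev := (List.replicate k Sym.cell ++ padRow n k w j).reverse ++ S.rev
        cnt := .sep :: S.cnt } () := by
  have h1 := ex_fill (k := .frm) (t := .tmp) (y := .rev) (s := .cell) (S := { S with
    inp := (List.range (2 * n + 1)).flatMap (fun (i : ℕ) => w ((i : ℤ) - n, (j : ℤ) - n)) ++ src })
    (by decide) (by decide) (by decide) rfl ht
  have h2 := ex_fill (k := .frm) (t := .tmp) (y := .rev) (s := .cell) (S := { S with
    inp := (List.range (2 * n + 1)).flatMap (fun (i : ℕ) => w ((i : ℤ) - n, (j : ℤ) - n)) ++ src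
    rev := .row :: (List.replicate k .cell ++ S.rev) })
    (by decide) (by decide) (by decide) rfl ht
  simp only [Store.get, Store.set, hk] at h1 h2
  have h0 : Ex (padSym .row) { S with
      inp := (List.range (2 * n + 1)).flatMap (fun (i : ℕ) => w ((i : ℤ) - n, (j : ℤ) - n)) ++ src }
      (18 * k + 10) () { S with
        inp := (List.range (2 * n + 1)).flatMap (fun (i : ℕ) => w ((i : ℤ) - n, (j : ℤ) - n)) ++ src
        rev := List.replicate k .cell ++ .row :: (List.replicate k .cell ++ S.rev)
        cnt := .sep :: S.cnt } :=
    Ex.bind h1 (Ex.bind (t := 1) Ex.push (Ex.bind (t' := 1) h2 Ex.push le_rfl) le_rfl)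
  have h3 := Ex.scan_step (k := .inp) (halt := fun s => decide (s = .sep)) (h := padSym) h rfl h0
  have h4 := Steps.copy (k := .inp) (y := .rev) (halt := fun s => decide (s = .sep)) (h := padSym)
    (l := (List.range (2 * n + 1)).flatMap (fun (i : ℕ) => w ((i : ℤ) - n, (j : ℤ) - n)))
    (r := src) (S := { S with
      inp := (List.range (2 * n + 1)).flatMap (fun (i : ℕ) => w ((i : ℤ) - n, (j : ℤ) - n)) ++ src
      rev := List.replicate k .cell ++ .row :: (List.replicate k .cell ++ S.rev)
      cnt := .sep :: S.cnt })
    (by decide) rfl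
    (fun s hs => by
      obtain ⟨i, hi, hs⟩ := List.mem_flatMap.1 hs
      rw [List.mem_range] at hi
      have := hmem _ ⟨abs_le.2 (by simp only; omega), abs_le.2 (by simp only; omega)⟩ s hs
      simpa using this.2)
    (fun s hs => by
      obtain ⟨i, hi, hs⟩ := List.mem_flatMap.1 hs
      rw [List.mem_range] at hi
      have := hmem _ ⟨abs_le.2 (by simp only; omega), abs_le.2 (by simp only; omega)⟩ s hs
      exact padSym_eq this.1)
  refine ((h3.trans h4).conv ?_).mono ?_
  · simp [padRow]
  · simp only [padRow, List.length_append, List.length_cons, List.length_replicate]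
    omega

theorem steps_padRows {n k q : ℕ} {w : ℤ × ℤ → List Sym} (S : Store)
    (hk : S.frm.length = k) (ht : S.tmp = [])
    (hmem : ∀ z, InBox n z → ∀ s ∈ w z, s ≠ .row ∧ s ≠ .sep)
    (hq : ∀ j < 2 * n + 1, 18 * k + 15 +
      4 * (padRow n k w j ++ List.replicate k Sym.cell).length ≤ q) (src : List Sym) :
    Steps (scanBody .inp (fun s => decide (s = .sep)) padSym)
      { S with
        inp := (List.range (2 * n)).flatMap (fun j => .row :: (List.range (2 * n + 1)).flatMap
          (fun (i : ℕ) => w ((i : ℤ) - n, ((j + 1 : ℕ) : ℤ) - n))) ++ src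
        cnt := [.sep] } () (2 * n * q)
      { S with
        inp := src
        rev := ((List.range (2 * n)).flatMap
          (fun j => List.replicate k Sym.cell ++ padRow n k w (j + 1))).reverse ++ S.rev
        cnt := List.replicate (2 * n + 1) .sep } () := by
  refine (Steps.pieces (f := scanBody .inp (fun s => decide (s = .sep)) padSym) (a := ())
    (fun src dst (i : ℕ) => { S with inp := src, rev := dst, cnt := List.replicate (i + 1) .sep })
    (fun (j : ℕ) => Sym.row :: (List.range (2 * n + 1)).flatMap (fun (i : ℕ) =>
      w ((i : ℤ) - n, ((j + 1 : ℕ) : ℤ) - n)))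
    (fun j => List.replicate k Sym.cell ++ padRow n k w (j + 1)) id q (2 * n)
    (fun j hj src dst => ?_) src S.rev)
  exact ((steps_padRow (j := j + 1) (S := { S with
    inp := _, rev := dst, cnt := List.replicate (j + 1) .sep }) hk ht hmem (by omega) rfl).conv
      (by simp [List.replicate_succ])).mono (hq _ (by omega))

theorem ex_prepare {n k l : ℕ} {w : ℤ × ℤ → List Sym} {F B rest : List Sym}
    (hF : ∀ s ∈ F, s ≠ .sep) (hk : F.length = k) (hB : ∀ s ∈ B, s ≠ .close) (hBl : B.length ≤ l)
    (hw : ∀ z, InBox (n + k) z → ¬ InBox n z → w z = [.cell])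
    (hcell : ∀ z, InBox n z → (w z).length ≤ l)
    (hmem : ∀ z, InBox n z → ∀ s ∈ w z, s ≠ .row ∧ s ≠ .sep) (hl : 2 * (n + k) + 1 ≤ l) :
    Ex prepare { inp := F ++ .sep :: (B ++ .close :: (grid n w ++ .sep :: rest)) }
      (400 * l ^ 3) none
      { inp := rest, frm := F.reverse, fwd := grid (n + k) w
        cnt := List.replicate (2 * (n + k) + 1) .sep } := by
  have hk' : F.reverse.length = k := by rw [List.length_reverse, hk]
  set src : ℕ → List Sym := fun j =>
    .row :: (List.range (2 * n + 1)).flatMap (fun (i : ℕ) => w ((i : ℤ) - n, (j : ℤ) - n)) with hsrc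
  have h1 := ex_move (k := .inp) (y := .frm) (halt := fun s => decide (s = .sep)) (l := F)
    (S := { inp := F ++ .sep :: (B ++ .close :: (grid n w ++ .sep :: rest)) }) (by decide) rfl
    (fun s hs => by simpa using hF s hs) rfl
  -- The binary number `n` is discarded: counting the row markers supplies the side of the grid in
  -- unary.
  have h2 := ex_skip (k := .inp) (halt := fun s => decide (s = .close)) (l := B)
    (S := { inp := B ++ .close :: (grid n w ++ .sep :: rest), frm := F.reverse }) rfl
    (fun s hs => by simpa using hB s hs) rfl
  set r0 := (List.range (2 * n + 1)).flatMap
      (fun (i : ℕ) => w ((i : ℤ) - n, ((0 : ℕ) : ℤ) - n)) with hr0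
  have hgrid : grid n w = .row :: (r0 ++ (List.range (2 * n)).flatMap (fun j => src (j + 1))) := by
    change (List.range (2 * n + 1)).flatMap src = src 0 ++ _
    rw [List.range_succ_eq_map, List.flatMap_cons, List.flatMap_map]
  set L := 2 * (n + k) + 1 with hL
  have hr : ∀ s ∈ r0, s ≠ .row ∧ s ≠ .sep := fun s hs => by
    obtain ⟨i, hi, hs⟩ := List.mem_flatMap.1 hs
    rw [List.mem_range] at hi
    exact hmem _ ⟨abs_le.2 (by simp only; omega), abs_le.2 (by simp only; omega)⟩ s hs
  have hr0l : r0.length ≤ l * l :=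
    (length_flatMap_range_le fun i hi => hcell _
      ⟨abs_le.2 (by simp only; omega), abs_le.2 (by simp only; omega)⟩).trans
      (Nat.mul_le_mul_right _ (by omega))
  set blank : List Sym := .row :: List.replicate L .cell with hblank
  set G := (List.range (2 * n + 1)).flatMap
    (fun j => padRow n k w j ++ List.replicate k Sym.cell) with hG
  have hpad : grid (n + k) w = (List.replicate k blank).flatten ++ G ++
      (List.replicate k blank).flatten := grid_pad n k w hw
  have hp0 : padRow n k w 0 = .row :: (List.replicate k .cell ++ r0) := rfl
  have h3 : Ex (.pop .inp) { inp := grid n w ++ .sep :: rest, frm := F.reverse } 1 (some .row)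
      { inp := r0 ++ ((List.range (2 * n)).flatMap (fun j => src (j + 1)) ++ .sep :: rest)
        frm := F.reverse } :=
    (Ex.pop_cons (by rw [hgrid]; rfl)).conv (by simp)
  have h4 := ex_fill (k := .frm) (t := .tmp) (y := .rev) (s := .cell)
    (S := { inp := r0 ++ ((List.range (2 * n)).flatMap (fun j => src (j + 1)) ++ .sep :: rest)
            frm := F.reverse, rev := [.row] }) (by decide) (by decide) (by decide) rfl rfl
  have h5 : Ex (scan .inp (fun s => decide (s = .sep)) padSym)
      { inp := r0 ++ ((List.range (2 * n)).flatMap (fun j => src (j + 1)) ++ .sep :: rest)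
        frm := F.reverse, rev := List.replicate k .cell ++ [.row], cnt := [.sep] }
      (4 * (l * l) + (2 * n * (22 * l + 15 + 4 * (l * l)) + 2)) (some .sep)
      { inp := rest, frm := F.reverse
        rev := ((List.range (2 * n)).flatMap
          (fun j => List.replicate k Sym.cell ++ padRow n k w (j + 1))).reverse ++
            (padRow n k w 0).reverse
        cnt := List.replicate (2 * n + 1) .sep } := by
    have e1 := Steps.copy (k := .inp) (y := .rev) (halt := fun s => decide (s = .sep)) (h := padSym)
      (l := r0) (r := (List.range (2 * n)).flatMap (fun j => src (j + 1)) ++ .sep :: rest)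
      (S := {
        inp := r0 ++ ((List.range (2 * n)).flatMap (fun j => src (j + 1)) ++ .sep :: rest)
        frm := F.reverse, rev := List.replicate k .cell ++ [.row], cnt := [.sep] })
      (by decide) rfl (fun s hs => by simpa using (hr s hs).2) (fun s hs => padSym_eq (hr s hs).1)
    have e2 := steps_padRows (n := n) (w := w) (q := 22 * l + 15 + 4 * (l * l))
      { frm := F.reverse, rev := (padRow n k w 0).reverse } hk' rfl hmem (fun j hj => by
        have := length_padRow_le hcell hl hj
        omega) (.sep :: rest)
    refine ((e1.conv ?_).mono ?_).run (e2.run (Ex.scan_stop rfl rfl))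
    · simp [hp0, hsrc]
    · omega
  have h6 := ex_fill (k := .frm) (t := .tmp) (y := .rev) (s := .cell)
    (S := { inp := rest, frm := F.reverse
            rev := ((List.range (2 * n)).flatMap
              (fun j => List.replicate k Sym.cell ++ padRow n k w (j + 1))).reverse ++
                (padRow n k w 0).reverse
            cnt := List.replicate (2 * n + 1) .sep }) (by decide) (by decide) (by decide) rfl rfl
  have h6' := h6.conv (S'' := { inp := rest, frm := F.reverse, rev := G.reverse
                                cnt := List.replicate (2 * n + 1) .sep }) (by
    rw [hG, flatMap_range_succ_append]
    simp [hk])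
  have h7 := ex_fill (k := .frm) (t := .tmp) (y := .cnt) (s := .sep)
    (S := { inp := rest, frm := F.reverse, rev := G.reverse
            cnt := List.replicate (2 * n + 1) .sep }) (by decide) (by decide) (by decide) rfl rfl
  have h8 := ex_fill (k := .frm) (t := .tmp) (y := .cnt) (s := .sep)
    (S := { inp := rest, frm := F.reverse, rev := G.reverse
            cnt := List.replicate k .sep ++ List.replicate (2 * n + 1) .sep })
    (by decide) (by decide) (by decide) rfl rfl
  have h8' := h8.conv (S'' := { inp := rest, frm := F.reverse, rev := G.reverse
                                cnt := List.replicate L .sep }) (by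
    simp only [Store.set, Store.get, hk', ← List.replicate_add]
    rw [show k + (k + (2 * n + 1)) = L by omega])
  -- The blank rows pushed on `rev` follow the grid in reading order. Those before it are pushed on
  -- `fwd` after pouring, cells first and row marker last.
  have h9 := ex_rep (k := .frm) (t := .tmp) (c := seq (.push .rev .row) (fill .cnt .prv .rev .cell))
    (a := none) (by decide) (fun i => { inp := rest
                                        rev := ((List.replicate i blank).flatten).reverse ++ G.reverse
                                        cnt := List.replicate L .sep }) F.reverse (9 * l + 5)
    (fun i _ r r' => by
      have e := ex_fill (k := .cnt) (t := .prv) (y := .rev) (s := .cell)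
        (S := { inp := rest
                rev := .row :: (((List.replicate i blank).flatten).reverse ++ G.reverse)
                cnt := List.replicate L .sep
                frm := r
                tmp := r' }) (by decide) (by decide) (by decide) rfl rfl
      refine Ex.bind (t := 1) Ex.push (e.conv ?_) ?_
      · simp [List.replicate_succ', hblank]
      · simp only [Store.get, List.length_replicate]; omega)
  have h10 := ex_pour (k := .rev) (y := .fwd)
    (S := { inp := rest, frm := F.reverse
            rev := ((List.replicate k blank).flatten).reverse ++ G.reverse
            cnt := List.replicate L .sep }) (by decide) rfl
  have h11 := ex_rep (k := .frm) (t := .tmp) (c := seq (fill .cnt .prv .fwd .cell) (.push .fwd .row))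
    (a := ()) (by decide) (fun i => { inp := rest
                                      fwd := (List.replicate i blank).flatten ++
                                        (G ++ (List.replicate k blank).flatten)
                                      cnt := List.replicate L .sep }) F.reverse (9 * l + 5)
    (fun i _ r r' => by
      have e := ex_fill (k := .cnt) (t := .prv) (y := .fwd) (s := .cell)
        (S := { inp := rest
                fwd := (List.replicate i blank).flatten ++ (G ++ (List.replicate k blank).flatten)
                cnt := List.replicate L .sep
                frm := r
                tmp := r' }) (by decide) (by decide) (by decide) rfl rfl
      refine Ex.bind e (t' := 1) (Ex.push.conv ?_) ?_
      · simp [List.replicate_succ, hblank]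
      · simp only [Store.get, List.length_replicate]; omega)
  have hlen : (((List.replicate k blank).flatten).reverse ++ G.reverse).length ≤
      l * (l * l + 1) := by
    have e1 : (grid (n + k) w).length ≤ L * (L * l + 1) := length_grid_le fun z hz => by
      by_cases hz' : InBox n z
      · exact hcell z hz'
      · rw [hw z hz hz', List.length_singleton]; omega
    rw [hpad] at e1
    simp only [List.length_append, List.length_reverse] at e1 ⊢
    have : L * (L * l + 1) ≤ l * (l * l + 1) := by gcongr
    omega
  rw [hpad]
  simp only [Store.get, Store.set, hk', hk, List.append_nil, List.replicate_zero, List.flatten_nil,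
    List.reverse_nil, List.nil_append, List.reverse_append, List.reverse_reverse,
    List.append_assoc] at h1 h2 h4 h6' h7 h8' h9 h10 h11 hlen ⊢
  refine Ex.bind h1 (Ex.bind h2 (Ex.bind h3 (Ex.bind (t := 1) Ex.push (Ex.bind h4
    (Ex.bind (t := 1) Ex.push (Ex.bind h5 (Ex.bind h6' (Ex.bind h7 (Ex.bind h8'
    (Ex.bind h9 (Ex.bind h10 h11 le_rfl) le_rfl) le_rfl) le_rfl) le_rfl)
    le_rfl) le_rfl) le_rfl) le_rfl) le_rfl) le_rfl) ?_
  have c1 : 2 * n * (22 * l + 15 + 4 * (l * l)) ≤ 22 * (l * l) + 15 * l + 4 * l ^ 3 :=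
    (Nat.mul_le_mul_right _ (by omega : 2 * n ≤ l)).trans_eq (by ring)
  have c2 : k * (9 * l + 5 + 9) ≤ 9 * (l * l) + 14 * l :=
    (Nat.mul_le_mul_right _ (by omega : k ≤ l)).trans_eq (by ring)
  have c3 : l ≤ l * l := Nat.le_mul_self l
  have c4 : l * l ≤ l ^ 3 := by rw [pow_succ, pow_two]; exact Nat.le_mul_of_pos_right _ (by omega)
  have c5 : l * (l * l + 1) = l ^ 3 + l := by ring
  have c6 : k ≤ l := by omega
  rw [c5] at hlen
  omega

/-! ### Binary counters and translating the grid -/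

/-- The number with the given binary digits, least significant digit first. -/
def bval (bs : List Bool) : ℕ := bs.foldr Nat.bit 0

theorem bval_bits (k : ℕ) : bval k.bits = k := by
  induction k using Nat.binaryRec' with
  | zero => simp [bval]
  | bit b n h ih => rw [Nat.bits_append_bit _ _ h, bval, List.foldr_cons, ← bval, ih]

/-- The binary digits of the predecessor. -/
def predBits : List Bool → List Bool
  | [] => []
  | true :: bs => false :: bs
  | false :: bs => if bval bs = 0 then [] else true :: predBits bs

theorem bval_predBits (bs : List Bool) : bval (predBits bs) = bval bs - 1 := by
  induction bs with
  | nil => rfl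
  | cons b bs ih =>
    cases b
    · rw [predBits]
      split_ifs with h
      · simp [bval] at h ⊢
        simp [h]
      · simp only [bval, List.foldr_cons, Nat.bit_val, Bool.toNat_true, Bool.toNat_false] at ih h ⊢
        omega
    · simp [predBits, bval, Nat.bit_val]

theorem length_predBits (bs : List Bool) : (predBits bs).length ≤ bs.length := by
  induction bs with
  | nil => rfl
  | cons b bs ih =>
    cases b
    · rw [predBits]
      split_ifs
      · simp
      · simpa using ih
    · simp [predBits]

/-- The body of `decrement`. -/
def decBody (_ : Unit) : Code (Unit ⊕ Bool) :=
  .bind (.pop .inp) fun s =>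
    match s with
    | some (.bit true) => seq (.push .inp (.bit false)) (seq (pour .tmp .inp) (.ret (.inr true)))
    | some (.bit false) => seq (.push .tmp (.bit true)) (.ret (.inl ()))
    | some s => seq (.push .inp s) (seq (clear .tmp) (.ret (.inr false)))
    | none => .ret (.inr false)

/-- Decrement the binary number on the stack `inp`, unless it is zero. -/
def decrement : Code Bool := .loop decBody ()

/-- `j` counts the low zeros passed so far, which become ones if a digit one is found to borrow
from. If there is none, the number was zero: the borrowed ones are dropped and the empty word is
left. -/
theorem ex_decrement_aux (bs : List Bool) (j : ℕ) (rest : List Sym) (S : Store)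
    (h : S.inp = bs.map Sym.bit ++ .close :: rest)
    (ht : S.tmp = List.replicate j (.bit true)) :
    Ex decrement S (4 * j + 8 * bs.length + 6) (decide (bval bs ≠ 0)) { S with
      inp := (if bval bs = 0 then [] else List.replicate j true ++ predBits bs).map Sym.bit ++
        .close :: rest
      tmp := [] } := by
  induction bs generalizing j S with
  | nil =>
    refine Ex.loop_exit (Ex.bind (t := 1) (t' := 4 * j + 4) (Ex.pop_cons h) ?_)
    refine Ex.bind (t := 1) Ex.push (Ex.bind (ex_clear rfl) (Ex.ret.conv ?_) le_rfl) ?_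
    · simp [bval]
    · simp [ht]
      omega
  | cons b bs ih =>
    cases b
    · have h1 : Ex (decBody ()) S 3 (.inl ()) { S with
          inp := bs.map Sym.bit ++ .close :: rest
          tmp := List.replicate (j + 1) (.bit true) } := by
        refine Ex.bind (t := 1) (t' := 2) (Ex.pop_cons h) ?_
        refine Ex.bind (t := 1) (t' := 1) Ex.push (Ex.ret.conv ?_)
        simp [ht, List.replicate_succ]
      have h2 := ih (j + 1) { S with
          inp := bs.map Sym.bit ++ .close :: rest
          tmp := List.replicate (j + 1) (.bit true) } rfl rfl
      have e : bval (false :: bs) = 2 * bval bs := by simp [bval, Nat.bit_val]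
      have e' : decide (bval (false :: bs) ≠ 0) = decide (bval bs ≠ 0) := by simp [e]
      rw [e']
      refine ((h1.steps.run h2).conv ?_).mono (by rw [List.length_cons]; omega)
      by_cases h0 : bval bs = 0
      · simp [e, h0]
      · simp [e, h0, predBits, List.replicate_succ']
    · have e : bval (true :: bs) ≠ 0 := by simp [bval, Nat.bit_val]
      have e' : decide (bval (true :: bs) ≠ 0) = true := by simp [e]
      rw [e']
      refine Ex.loop_exit (Ex.bind (t := 1) (t' := 4 * j + 4) (Ex.pop_cons h) ?_)
      refine Ex.bind (t := 1) Ex.push (Ex.bind (ex_pour (by decide) rfl) (Ex.ret.conv ?_) le_rfl) ?_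
      · simp [e, predBits, ht]
      · simp [ht]
        omega

theorem predBits_of_bval_eq_zero {bs : List Bool} (h : bval bs = 0) : predBits bs = [] := by
  cases bs with
  | nil => rfl
  | cons b bs =>
    cases b <;> simp_all [predBits, bval, Nat.bit_val]

theorem ex_decrement (bs : List Bool) (rest : List Sym) (S : Store)
    (h : S.inp = bs.map Sym.bit ++ .close :: rest) (ht : S.tmp = []) :
    Ex decrement S (8 * bs.length + 6) (decide (bval bs ≠ 0)) { S with
      inp := (predBits bs).map Sym.bit ++ .close :: rest } := by
  refine ((ex_decrement_aux bs 0 rest S h (by simpa using ht)).conv ?_).mono (by omega)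
  by_cases h0 : bval bs = 0
  · simp [h0, predBits_of_bval_eq_zero h0, ← ht]
  · simp [h0, ← ht]

/-- Read a number, and replace the value at each position by the value that many steps in the
direction `d`. -/
def shift (d : Dir) : Code Unit :=
  seq (rep .cnt .frm (.bind decrement fun b => seq (if b then dirPass false d else .ret none)
    (.ret ())))
    (seq (scan .inp (fun s => decide (s = .close)) fun _ => .ret ()) (.ret ()))

/-- Read a coordinate of the position. -/
def readCoord (d e : Dir) : Code Unit :=
  .bind (.pop .inp) fun s =>
    match s with
    | some .minus => shift e
    | some s => seq (.push .inp s) (shift d)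
    | none => .ret ()

section

variable {N l : ℕ} {ns : ℤ × ℤ → List (Bool × List Bool)} {Q : ℤ × ℤ → Prop} {d : Dir}

theorem Dir.coord_iterate (d : Dir) (k : ℕ) (z : ℤ × ℤ) :
    d.coord (d.move^[k] z) = d.coord z + k := by
  induction k with
  | zero => simp
  | succ k ih =>
    rw [Function.iterate_succ_apply', Dir.coord_move_self, ih]
    push_cast
    ring

theorem Dir.neg_le_coord {z : ℤ × ℤ} (hz : InBox N z) (d : Dir) : -(N : ℤ) ≤ d.coord z := by
  have h1 := abs_le.1 hz.1
  have h2 := abs_le.1 hz.2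
  cases d <;> simp only [coord] <;> omega

/-- Once `j` steps have reached coordinate `N`, further steps in the same direction do not matter.
-/
theorem StableFrom.iterate {N : ℤ} (hQ : StableFrom Q d N) {z : ℤ × ℤ} {j k : ℕ}
    (hj : N ≤ d.coord z + j) (hjk : j ≤ k) : Q (d.move^[k] z) ↔ Q (d.move^[j] z) := by
  induction k, hjk using Nat.le_induction with
  | base => rfl
  | succ k hk ih =>
    rw [Function.iterate_succ_apply', ← ih]
    exact hQ _ (by rw [Dir.coord_iterate]; omega)

theorem predBits_iterate (bs : List Bool) (i : ℕ) :
    bval (predBits^[i] bs) = bval bs - i ∧ (predBits^[i] bs).length ≤ bs.length := by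
  induction i with
  | zero => simp
  | succ i ih =>
    rw [Function.iterate_succ_apply']
    exact ⟨by rw [bval_predBits, ih.1]; omega, (length_predBits _).trans ih.2⟩

open Classical in
-- The number is not bounded polynomially, so it is not counted down to zero: `cnt` limits the
-- rounds to `2N+1`. Round `i` translates once more while the counter is positive and is idle
-- afterwards, whence the exponent `min i (bval bs)`. At the border a cell keeps its own value,
-- which is right by stability. The formula stack is empty by now and serves as the auxiliary stack,
-- since `decrement` uses `tmp`.
theorem ex_shift (hQ : StableFrom Q d N) (bs : List Bool) (rest : List Sym) (hN : 2 * N + 1 ≤ l)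
    (hl : ∀ z, InBox N z → (cellOf [true] (ns z)).length ≤ l) (hbs : bs.length ≤ l) :
    Ex (shift d)
      (stage (bs.map Sym.bit ++ .close :: rest) (List.replicate (2 * N + 1) .sep) []
        (grid N fun z => cellOf [decide (Q z)] (ns z)))
      (200 * l ^ 4) ()
      (stage rest (List.replicate (2 * N + 1) .sep) []
        (grid N fun z => cellOf [decide (Q (d.move^[bval bs] z))] (ns z))) := by
  have h1 := ex_rep (k := .cnt) (t := .frm) (a := ()) (c := .bind decrement fun b =>
      seq (if b then dirPass false d else .ret none) (.ret ())) (by decide)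
    (fun i => { inp := (predBits^[i] bs).map Sym.bit ++ .close :: rest
                fwd := grid N fun z => cellOf [decide (Q (d.move^[min i (bval bs)] z))] (ns z) })
    (List.replicate (2 * N + 1) .sep) (8 * l + 6 + (100 * l ^ 3 + 1)) (fun i hi r r' => by
      have hp := predBits_iterate bs i
      have e1 := ex_decrement (predBits^[i] bs) rest
        { inp := (predBits^[i] bs).map Sym.bit ++ .close :: rest, cnt := r, frm := r'
          fwd := grid N fun z => cellOf [decide (Q (d.move^[min i (bval bs)] z))] (ns z) } rfl rfl
      refine Ex.bind (e1.mono (t' := 8 * l + 6) (by omega))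
        (Ex.bind (t' := 1) (t := 100 * l ^ 3) (a := none) ?_ .ret le_rfl) le_rfl
      rw [hp.1]
      by_cases hv : i < bval bs
      · rw [decide_eq_true (by omega), if_pos rfl, Function.iterate_succ_apply',
          min_eq_left hv.le, min_eq_left hv]
        refine ex_dirPass (star := false) (d := d) (m := l)
          (f := fun z => decide (Q (d.move^[i] z))) (bs := fun _ => [])
          (new := fun z => decide (Q (d.move^[i + 1] z)))
          { inp := (predBits (predBits^[i] bs)).map Sym.bit ++ .close :: rest, cnt := r, frm := r' }
          hN hl (fun z _ => ?_)
        by_cases hz : d.coord z < N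
        · simp only [combine, hz, if_true, if_false, Option.getD_some, Bool.false_eq_true]
          exact decide_eq_decide.2 (by rw [Function.iterate_succ_apply])
        · simp only [combine, hz, if_false, Option.getD_none, Bool.false_eq_true]
          exact decide_eq_decide.2 (hQ.iterate (by omega) (Nat.le_succ _))
      · rw [decide_eq_false (by omega), if_neg (by simp), Function.iterate_succ_apply',
          min_eq_right (by omega), min_eq_right (by omega)]
        exact Ex.ret.mono (by have := Nat.pow_pos (n := 3) (show 0 < l by omega); omega))
  have hp := predBits_iterate bs (2 * N + 1)
  have h2 := ex_skip (k := .inp) (halt := fun s => decide (s = .close))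
    (l := (predBits^[2 * N + 1] bs).map Sym.bit) (r := rest)
    (S := stage ((predBits^[2 * N + 1] bs).map Sym.bit ++ .close :: rest)
      (List.replicate (2 * N + 1) .sep) []
        (grid N fun z => cellOf [decide (Q (d.move^[bval bs] z))] (ns z))) rfl
    (fun s hs => by
      obtain ⟨b, _, rfl⟩ := List.mem_map.1 hs
      rfl) rfl
  have hg : (grid N fun z => cellOf [decide (Q (d.move^[min (2 * N + 1) (bval bs)] z))] (ns z)) =
      grid N fun z => cellOf [decide (Q (d.move^[bval bs] z))] (ns z) := by
    refine grid_congr fun z hz => ?_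
    have e : decide (Q (d.move^[min (2 * N + 1) (bval bs)] z)) =
        decide (Q (d.move^[bval bs] z)) := by
      rw [decide_eq_decide]
      by_cases hv : bval bs ≤ 2 * N + 1
      · rw [min_eq_right hv]
      -- Coordinates in the square are at least `-N`, so `2N+1` steps lead from any cell beyond `N`,
      -- where the remaining steps are irrelevant.
      · rw [min_eq_left (by omega), hQ.iterate _ (Nat.le_of_not_le hv)]
        have := Dir.neg_le_coord hz d
        push_cast
        omega
    rw [e]
  simp only [List.length_replicate, Function.iterate_zero, id_eq, hg, zero_min] at h1
  refine Ex.bind h1 (Ex.bind h2 .ret le_rfl) ?_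
  have c1 : (2 * N + 1) * (8 * l + 6 + (100 * l ^ 3 + 1) + 9) ≤
      8 * l ^ 2 + 16 * l + 100 * l ^ 4 :=
    (Nat.mul_le_mul_right _ hN).trans_eq (by ring)
  have c2 : l ≤ l ^ 4 := Nat.le_self_pow (by norm_num) l
  have c3 : l ^ 2 ≤ l ^ 4 := Nat.pow_le_pow_right (by omega) (by norm_num)
  rw [List.length_map]
  omega

open Classical in
theorem ex_readCoord {e : Dir} (hQ : StableFrom Q d N) (hQ' : StableFrom Q e N) (x : ℤ)
    (rest : List Sym) (hN : 2 * N + 1 ≤ l)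
    (hl : ∀ z, InBox N z → (cellOf [true] (ns z)).length ≤ l) (hx : (intWord x).length ≤ l) :
    Ex (readCoord d e)
      (stage (intWord x ++ rest) (List.replicate (2 * N + 1) .sep) []
        (grid N fun z => cellOf [decide (Q z)] (ns z)))
      (200 * l ^ 4 + 4) ()
      (stage rest (List.replicate (2 * N + 1) .sep) []
        (grid N fun z => cellOf
          [decide (Q (((if x < 0 then e else d).move)^[x.natAbs] z))] (ns z))) := by
  have hb : x.natAbs.bits.length ≤ l := by
    simp only [intWord, natWord, List.length_append, List.length_map] at hx
    omega
  have hv := bval_bits x.natAbs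
  by_cases h0 : x < 0
  · have h1 := ex_shift hQ' x.natAbs.bits rest hN hl hb
    rw [hv] at h1
    simp only [h0, if_true]
    exact Ex.bind (t := 1) (Ex.pop_cons (s := .minus) (by simp [intWord, natWord, h0])) h1
  · have h1 := ex_shift hQ x.natAbs.bits rest hN hl hb
    rw [hv] at h1
    simp only [h0, if_false]
    have e0 : intWord x ++ rest = x.natAbs.bits.map Sym.bit ++ .close :: rest := by
      simp [intWord, natWord, h0]
    rw [e0]
    rcases hbits : x.natAbs.bits with _ | ⟨b, t⟩
    · rw [hbits] at h1
      refine Ex.bind (t := 1) (Ex.pop_cons (s := .close) rfl) ?_ (t' := 200 * l ^ 4 + 1)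
      exact Ex.bind (t := 1) Ex.push h1
    · rw [hbits] at h1
      refine Ex.bind (t := 1) (Ex.pop_cons (s := .bit b) rfl) ?_ (t' := 200 * l ^ 4 + 1)
      exact Ex.bind (t := 1) Ex.push h1

end

/-! ### Reading off the middle cell -/

/-- Copy the value of each cell to the stacks `rev` and `acc`. -/
def collect : Sym → Code Unit
  | .cell => .bind (.pop .fwd) fun s =>
    seq (.push .rev (s.getD .cell)) (.push .acc (s.getD .cell))
  | _ => .ret ()

/-- The body of `middle`. -/
def middleBody (_ : Unit) : Code (Unit ⊕ Unit) :=
  seq (.pop .rev) (.bind (.pop .rev) fun s =>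
    match s with
    | some _ => seq (.pop .acc) (.ret (.inl ()))
    | none => .ret (.inr ()))

/-- The value in the cell in the middle of the grid. -/
def middle : Code Bool :=
  seq (each .fwd collect) <| seq (.loop middleBody ()) <| .bind (.pop .acc) fun s =>
    seq (clear .acc) <| seq (clear .cnt) <| .ret ((readBit s).getD false)

theorem collect_eq {s : Sym} (h : s ≠ .cell) : collect s = .ret () := by
  cases s <;> first | rfl | contradiction

/-- The values in the cells of a grid. -/
def values (N : ℕ) (v : ℤ × ℤ → Bool) : List Sym :=
  (List.range (2 * N + 1)).flatMap fun (j : ℕ) =>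
    (List.range (2 * N + 1)).map fun (i : ℕ) => .bit (v ((i : ℤ) - N, (j : ℤ) - N))

/-- The side is odd, so the origin has `N` full rows and half a row on either side in reading order.
-/
theorem values_eq (N : ℕ) (v : ℤ × ℤ → Bool) :
    ∃ a b : List Sym, a.length = b.length ∧ values N v = a ++ .bit (v (0, 0)) :: b := by
  have e : 2 * N + 1 = N + (1 + N) := by omega
  have hl : ∀ f : ℕ → ℕ, ((List.range N).flatMap fun j =>
      (List.range (2 * N + 1)).map fun (i : ℕ) =>
        Sym.bit (v ((i : ℤ) - N, ((f j : ℕ) : ℤ) - N))).length = N * (2 * N + 1) := by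
    intro f
    simp [List.length_flatMap]
  have hrow : ∃ a b : List Sym, a.length = b.length ∧
      ((List.range (2 * N + 1)).map fun (i : ℕ) => Sym.bit (v ((i : ℤ) - N, 0))) =
        a ++ .bit (v (0, 0)) :: b := by
    refine ⟨(List.range N).map fun (i : ℕ) => Sym.bit (v ((i : ℤ) - N, 0)),
      (List.range N).map fun (i : ℕ) => Sym.bit (v (((N + (1 + i) : ℕ) : ℤ) - N, 0)), by simp, ?_⟩
    rw [e, List.range_add, List.map_append, List.range_add]
    simp
    exact fun i _ => by rw [show (N : ℤ) + 1 + i - N = 1 + i by ring]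
  obtain ⟨a, b, hab, hrow⟩ := hrow
  refine ⟨((List.range N).flatMap fun j => (List.range (2 * N + 1)).map fun (i : ℕ) =>
      Sym.bit (v ((i : ℤ) - N, ((j : ℕ) : ℤ) - N))) ++ a,
    b ++ (List.range N).flatMap fun j => (List.range (2 * N + 1)).map fun (i : ℕ) =>
      Sym.bit (v ((i : ℤ) - N, ((N + (1 + j) : ℕ) : ℤ) - N)), ?_, ?_⟩
  · rw [List.length_append, List.length_append, hl fun j => j, hl fun j => N + (1 + j)]
    omega
  · have e1 : List.range (2 * N + 1) =
        List.range N ++ ([N] ++ (List.range N).map fun j => N + (1 + j)) := by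
      rw [e, List.range_add, List.range_add]
      simp [add_assoc]
    have e2 : values N v = ((List.range N ++ ([N] ++ (List.range N).map fun j => N + (1 + j)))).flatMap
        fun (j : ℕ) => (List.range (2 * N + 1)).map fun (i : ℕ) =>
          Sym.bit (v ((i : ℤ) - N, (j : ℤ) - N)) := by rw [← e1]; rfl
    rw [e2, List.flatMap_append, List.flatMap_append, List.flatMap_map, List.flatMap_singleton,
      sub_self, hrow]
    simp

/-- Two copies of the list are popped at different speeds, two symbols from `rev` for each one from
`acc`; when `rev` is exhausted, the middle entry is on top of `acc`. -/
theorem ex_middleBody_loop (p : List Sym) {q r : List Sym} {S : Store} (hr : S.rev = r)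
    (hrl : r.length = 2 * p.length + 1) (ha : S.acc = p ++ q) :
    Ex (.loop middleBody ()) S (5 * p.length + 3) () { S with rev := [], acc := q } := by
  induction p generalizing S r with
  | nil =>
    obtain ⟨s, rfl⟩ := List.length_eq_one_iff.1 hrl
    refine Ex.loop_exit ?_
    refine Ex.bind (t := 1) (t' := 2) (Ex.pop_cons hr) ?_
    refine Ex.bind (t := 1) (t' := 1) (Ex.pop_nil rfl) (Ex.ret.conv ?_)
    simp_all
  | cons x p ih =>
    obtain _ | ⟨s, _ | ⟨s', r⟩⟩ := r
    · simp at hrl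
    · simp at hrl
    have h1 : Ex (middleBody ()) S 4 (.inl ()) { S with rev := r, acc := p ++ q } := by
      refine Ex.bind (t := 1) (t' := 3) (Ex.pop_cons hr) ?_
      refine Ex.bind (t := 1) (t' := 2) (Ex.pop_cons rfl) ?_
      exact Ex.bind (t := 1) (t' := 1) (Ex.pop_cons ha) Ex.ret
    have h2 := ih (r := r) (S := { S with rev := r, acc := p ++ q }) rfl (by simp at hrl; omega) rfl
    exact (h1.steps.run h2).mono (by rw [List.length_cons]; omega)

theorem ex_middle {N l : ℕ} {ns : ℤ × ℤ → List (Bool × List Bool)} (v : ℤ × ℤ → Bool)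
    (hN : 2 * N + 1 ≤ l) (hl : ∀ z, InBox N z → (cellOf [true] (ns z)).length ≤ l) :
    Ex middle
      (stage [] (List.replicate (2 * N + 1) .sep) [] (grid N fun z => cellOf [v z] (ns z)))
      (100 * l ^ 3) (v (0, 0)) {} := by
  obtain ⟨a, b, hab, hv⟩ := values_eq N v
  have hcell : ∀ z, InBox N z → ∀ src dst, Steps (scanBody .fwd (fun _ => false) collect)
      { fwd := cellOf [v z] (ns z) ++ src, rev := dst, acc := dst
        cnt := List.replicate (2 * N + 1) .sep } () (4 * l + 10)
      { fwd := src, rev := .bit (v z) :: dst, acc := .bit (v z) :: dst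
        cnt := List.replicate (2 * N + 1) .sep } () := by
    intro z hz src dst
    have h1 : Ex (collect .cell)
        { fwd := .bit (v z) :: ((ns z).flatMap nameWord ++ src), rev := dst, acc := dst
          cnt := List.replicate (2 * N + 1) .sep } 3 ()
        { fwd := (ns z).flatMap nameWord ++ src, rev := .bit (v z) :: dst, acc := .bit (v z) :: dst
          cnt := List.replicate (2 * N + 1) .sep } := by
      refine Ex.bind (t := 1) (t' := 2) (Ex.pop_cons rfl) ?_
      exact Ex.bind (t := 1) (t' := 1) Ex.push Ex.push
    have h2 : ∀ (w : List Sym) (S : Store), (∀ s ∈ w, s ≠ .cell) → S.fwd = w ++ src →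
        Steps (scanBody .fwd (fun _ => false) collect) S () (4 * w.length)
          { S with fwd := src } () := by
      intro w
      induction w with
      | nil => intro S _ hS; exact Steps.refl.conv (by rw [← List.nil_append src, ← hS])
      | cons s w ih =>
        intro S hw hS
        have e := Ex.scan_step (k := .fwd) (halt := fun _ => false) (h := collect) (S := S) (t := 1)
          (a := ()) hS rfl (by rw [collect_eq (hw s (by simp))]; exact Ex.ret)
        exact (e.trans (ih _ (fun s hs => hw s (by simp [hs])) rfl)).mono
          (by rw [List.length_cons]; omega)
    have h3 := Ex.scan_step (k := .fwd) (halt := fun _ => false) (h := collect) (s := .cell)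
      (S := { fwd := cellOf [v z] (ns z) ++ src, rev := dst, acc := dst
              cnt := List.replicate (2 * N + 1) .sep }) rfl rfl h1
    refine (h3.trans (h2 _ _ (fun s hs => (mem_cellOf_tail (bs := [])
      (by simpa using hs)).1) rfl)).mono ?_
    have := hl z hz
    simp only [cellOf, List.length_cons, List.length_append] at this
    omega
  have h1 : Steps (scanBody .fwd (fun _ => false) collect)
      (stage [] (List.replicate (2 * N + 1) .sep) [] (grid N fun z => cellOf [v z] (ns z))) ()
      ((2 * N + 1) * ((2 * N + 1) * (4 * l + 10) + 4))
      { rev := (values N v).reverse, acc := (values N v).reverse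
        cnt := List.replicate (2 * N + 1) .sep } () := by
    have := Steps.pieces (f := scanBody .fwd (fun _ => false) collect) (a := ())
      (fun src dst (_ : Unit) => { fwd := src, rev := dst, acc := dst
                                   cnt := List.replicate (2 * N + 1) .sep })
      (fun (j : ℕ) => Sym.row :: (List.range (2 * N + 1)).flatMap fun (i : ℕ) =>
        cellOf [v ((i : ℤ) - N, (j : ℤ) - N)] (ns ((i : ℤ) - N, (j : ℤ) - N)))
      (fun (j : ℕ) => (List.range (2 * N + 1)).map fun (i : ℕ) =>
        Sym.bit (v ((i : ℤ) - N, (j : ℤ) - N))) (fun _ => ())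
      ((2 * N + 1) * (4 * l + 10) + 4) (2 * N + 1) (fun j hj src dst => ?_) [] []
    · simp only [List.append_nil] at this
      exact this
    · have e1 := Ex.scan_step (k := .fwd) (halt := fun _ => false) (h := collect) (s := .row)
        (S := { fwd := (.row :: (List.range (2 * N + 1)).flatMap fun (i : ℕ) =>
                  cellOf [v ((i : ℤ) - N, (j : ℤ) - N)] (ns ((i : ℤ) - N, (j : ℤ) - N))) ++ src
                rev := dst, acc := dst, cnt := List.replicate (2 * N + 1) .sep })
        (a := ()) (t := 1) rfl rfl Ex.ret
      have e2 := Steps.pieces (f := scanBody .fwd (fun _ => false) collect) (a := ())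
        (fun src dst (_ : Unit) => { fwd := src, rev := dst, acc := dst
                                     cnt := List.replicate (2 * N + 1) .sep })
        (fun (i : ℕ) =>
          cellOf [v ((i : ℤ) - N, (j : ℤ) - N)] (ns ((i : ℤ) - N, (j : ℤ) - N)))
        (fun (i : ℕ) => [Sym.bit (v ((i : ℤ) - N, (j : ℤ) - N))]) (fun _ => ())
        (4 * l + 10) (2 * N + 1)
        (fun i hi src dst => hcell _
          ⟨abs_le.2 (by simp only; omega), abs_le.2 (by simp only; omega)⟩ src dst) src dst
      rw [← List.map_eq_flatMap] at e2
      exact (e1.trans e2).mono (by omega)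
  rw [hv] at h1
  have hb : a.length ≤ l * l := by
    have e1 := congrArg List.length hv
    have e2 : (values N v).length = (2 * N + 1) * (2 * N + 1) := by
      simp [values, List.length_flatMap]
    have e3 := Nat.mul_le_mul hN hN
    simp only [List.length_append, List.length_cons] at e1
    omega
  have h2 := ex_middleBody_loop b.reverse (q := .bit (v (0, 0)) :: a.reverse)
    (S := { rev := (a ++ .bit (v (0, 0)) :: b).reverse, acc := (a ++ .bit (v (0, 0)) :: b).reverse
            cnt := List.replicate (2 * N + 1) .sep }) rfl
    (by simp [hab]; omega) (by simp)
  have h3 := ex_clear (k := .acc) (S := { acc := a.reverse, cnt := List.replicate (2 * N + 1) .sep })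
    rfl
  have h4 := ex_clear (k := .cnt) (S := { cnt := List.replicate (2 * N + 1) .sep }) rfl
  refine Ex.bind (h1.run (Ex.scan_nil rfl)) (Ex.bind h2 (Ex.bind (t := 1) (Ex.pop_cons rfl)
    (Ex.bind h3 (Ex.bind h4 .ret le_rfl) le_rfl) le_rfl) le_rfl) ?_
  simp only [Store.get, List.length_reverse, List.length_replicate]
  have c1 : (2 * N + 1) * ((2 * N + 1) * (4 * l + 10) + 4) ≤ 4 * l ^ 3 + 10 * (l * l) + 4 * l :=
    calc _ ≤ l * (l * (4 * l + 10) + 4) := by gcongr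
      _ = _ := by ring
  have c3 : l ≤ l * l := Nat.le_mul_self l
  have c4 : l * l ≤ l ^ 3 := by rw [pow_succ, pow_two]; exact Nat.le_mul_of_pos_right _ (by omega)
  omega

/-! ### The complete model checker -/

theorem Dir.coord_move_of_ne {d e : Dir} (h : d.vert ≠ e.vert) (z : ℤ × ℤ) :
    e.coord (d.move z) = e.coord z := by
  cases d <;> cases e <;> simp [vert, coord, move] at h ⊢

/-- The second coordinate is applied to a grid already translated along the other axis. A
perpendicular translation does not move the stability threshold. -/
theorem StableFrom.shift {Q : ℤ × ℤ → Prop} {N : ℤ} {d e : Dir} (hQ : StableFrom Q e N)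
    (h : d.vert ≠ e.vert) (k : ℕ) : StableFrom (fun z => Q (d.move^[k] z)) e N := by
  intro z hz
  have hc : e.coord (d.move^[k] z) = e.coord z := by
    induction k with
    | zero => rfl
    | succ k ih => rw [Function.iterate_succ_apply', Dir.coord_move_of_ne h, ih]
  change Q (d.move^[k] (e.move z)) ↔ Q (d.move^[k] z)
  rw [Function.Commute.iterate_left (g := e.move) (fun z => d.move_comm e z) k z]
  exact hQ _ (by omega)

theorem move_iterate_fst (x : ℤ) (z : ℤ × ℤ) :
    (if x < 0 then Dir.left else Dir.right).move^[x.natAbs] z = (z.1 + x, z.2) := by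
  have h1 : ∀ k : ℕ, Dir.left.move^[k] z = (z.1 - k, z.2) := fun k => by
    induction k with
    | zero => simp
    | succ k ih =>
      rw [Function.iterate_succ_apply', ih]
      simp [Dir.move]
      ring
  have h2 : ∀ k : ℕ, Dir.right.move^[k] z = (z.1 + k, z.2) := fun k => by
    induction k with
    | zero => simp
    | succ k ih =>
      rw [Function.iterate_succ_apply', ih]
      simp [Dir.move]
      ring
  split_ifs
  · rw [h1, Prod.mk.injEq]
    omega
  · rw [h2, Prod.mk.injEq]
    omega

theorem move_iterate_snd (y : ℤ) (z : ℤ × ℤ) :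
    (if y < 0 then Dir.down else Dir.up).move^[y.natAbs] z = (z.1, z.2 + y) := by
  have h1 : ∀ k : ℕ, Dir.down.move^[k] z = (z.1, z.2 - k) := fun k => by
    induction k with
    | zero => simp
    | succ k ih =>
      rw [Function.iterate_succ_apply', ih]
      simp [Dir.move]
      ring
  have h2 : ∀ k : ℕ, Dir.up.move^[k] z = (z.1, z.2 + k) := fun k => by
    induction k with
    | zero => simp
    | succ k ih =>
      rw [Function.iterate_succ_apply', ih]
      simp [Dir.move]
      ring
  split_ifs
  · rw [h1, Prod.mk.injEq]
    omega
  · rw [h2, Prod.mk.injEq]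
    omega

/-- The model checker. -/
def modelCheck : Code Bool :=
  seq prepare <| seq (each .frm evalTok) <| seq (readCoord .right .left) <|
    seq (readCoord .up .down) middle

theorem mem_formulaWord {Atm : Type} [Encodable Atm] {m : ℕ} {φ : Formula Atm (Fin m)} {s : Sym}
    (h : s ∈ formulaWord φ) : s ≠ .sep := by
  induction φ with
  | atom p =>
    simp only [formulaWord, atomWord, natWord, List.mem_cons, List.mem_append, List.mem_map,
      List.not_mem_nil, or_false] at h
    rcases h with rfl | ⟨b, _, rfl⟩ | rfl <;> simp
  | here i =>
    simp only [formulaWord, hereWord, natWord, List.mem_cons, List.mem_append, List.mem_map,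
      List.not_mem_nil, or_false] at h
    rcases h with rfl | ⟨b, _, rfl⟩ | rfl <;> simp
  | neg φ ih =>
    rcases List.mem_cons.1 h with rfl | h
    · simp
    · exact ih h
  | and φ ψ ih1 ih2 =>
    rcases List.mem_cons.1 h with rfl | h
    · simp
    · rcases List.mem_append.1 h with h | h
      · exact ih1 h
      · exact ih2 h
  | box α φ ih =>
    rcases List.mem_cons.1 h with rfl | h
    · simp
    · exact ih h

namespace Instance

variable {Atm : Type} [Encodable Atm] {m : ℕ} (I : Instance Atm m)

/-- The names in the cell `z`. -/
noncomputable def names (z : ℤ × ℤ) : List (Bool × List Bool) :=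
  ((List.finRange m).filter (fun i => I.model.P i = z)).map (fun i : Fin m => (true, (i : ℕ).bits)) ++
    (((I.finite z).image Encodable.encode).toFinset.sort (· ≤ ·)).map (fun k => (false, k.bits))

theorem cellWord_eq (z : ℤ × ℤ) : I.cellWord z = cellOf [] (I.names z) := by
  simp [cellWord, names, cellOf, List.flatMap_append, List.flatMap_map, nameWord, kindSym]
  rfl

theorem bits_injective : Function.Injective Nat.bits := fun a b h => by
  rw [← bval_bits a, h, bval_bits]

theorem atom_mem_names (z : ℤ × ℤ) (p : Atm) :
    (false, (Encodable.encode p).bits) ∈ I.names z ↔ p ∈ I.model.V z := by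
  simp [names, bits_injective.eq_iff]

theorem here_mem_names (z : ℤ × ℤ) (i : Fin m) :
    (true, (i : ℕ).bits) ∈ I.names z ↔ I.model.P i = z := by
  simp [names, bits_injective.eq_iff, Fin.val_inj]

theorem coords_eq (n : ℕ) :
    coords n = (List.range (2 * n + 1)).map fun (j : ℕ) => (j : ℤ) - n := by
  simp [coords, List.map_eq_flatMap, List.flatMap_assoc]

theorem gridWord_eq : I.gridWord = grid I.n I.cellWord := by
  simp only [gridWord, grid, coords_eq, List.flatMap_map]

theorem cellWord_of_not_inBox {z : ℤ × ℤ} (hz : ¬ InBox I.n z) : I.cellWord z = [.cell] := by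
  have h1 : ∀ i, I.model.P i ≠ z := fun i h => hz (h ▸ I.bounded.1 i)
  simp [cellWord, I.bounded.2 z hz, h1]

theorem mem_cellWord {z : ℤ × ℤ} {s : Sym} (h : s ∈ I.cellWord z) : s ≠ .row ∧ s ≠ .sep := by
  rw [cellWord_eq, cellOf] at h
  rcases List.mem_cons.1 h with rfl | h
  · simp
  · exact (mem_cellOf_tail h).2

theorem length_cellWord_le {z : ℤ × ℤ} (hz : InBox I.n z) :
    (I.cellWord z).length ≤ I.gridWord.length := by
  have h1 := abs_le.1 hz.1
  have h2 := abs_le.1 hz.2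
  have mem : ∀ x : ℤ, -(I.n : ℤ) ≤ x → x ≤ I.n → x ∈ coords I.n := fun x hx hx' => by
    simp only [coords_eq, List.mem_map, List.mem_range]
    exact ⟨(x + I.n).toNat, by omega, by omega⟩
  have e1 : (I.cellWord z).length ≤
      ((coords I.n).flatMap fun x => I.cellWord (x, z.2)).length := by
    rw [List.length_flatMap]
    exact List.single_le_sum (by simp) _ (List.mem_map.2 ⟨z.1, mem _ h1.1 h1.2, rfl⟩)
  have e2 : (Sym.row :: (coords I.n).flatMap fun x => I.cellWord (x, z.2)).length ≤
      I.gridWord.length := by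
    rw [gridWord, List.length_flatMap]
    exact List.single_le_sum (by simp) _ (List.mem_map.2 ⟨z.2, mem _ h2.1 h2.2, rfl⟩)
  rw [List.length_cons] at e2
  omega

/-- Every row contributes at least its marker. This makes the side of the square linear in the
instance although `n` is written in binary. -/
theorem le_length_gridWord : 2 * I.n + 1 ≤ I.gridWord.length := by
  rw [gridWord, List.length_flatMap]
  refine le_of_eq_of_le ?_ (List.length_le_sum_of_one_le _ fun i hi => ?_)
  · simp [coords_eq]
  · obtain ⟨y, _, rfl⟩ := List.mem_map.1 hi
    simp

theorem ex_modelCheck : Ex modelCheck { inp := I.encode }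
    (1100 * (2 * I.encode.length + 1) ^ 4) I.answer {} := by
  classical
  -- Large enough for the padded side `2 * N + 1`, for the formula and for every cell, including the
  -- values stacked in it during evaluation.
  set l := 2 * I.encode.length + 1 with hl
  set s := (formulaWord I.formula).length with hs
  set N := I.n + s with hN
  have hlen : s + 1 + (natWord I.n).length + I.gridWord.length + 1 +
      (intWord I.position.1).length + (intWord I.position.2).length = I.encode.length := by
    simp only [encode, List.length_append, List.length_cons]
    omega
  have hgrid := I.le_length_gridWord
  have hNl : 2 * N + 1 ≤ l := by omega
  have hcell : ∀ z, (cellOf [] (I.names z)).length + s ≤ l := fun z => by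
    rw [← cellWord_eq]
    by_cases hz : InBox I.n z
    · have := I.length_cellWord_le hz
      omega
    · rw [I.cellWord_of_not_inBox hz, List.length_singleton]
      omega
  have hs0 : 0 < s := formulaWord_length_pos I.formula
  have hcell' : ∀ z, InBox N z → (cellOf [true] (I.names z)).length ≤ l := fun z _ => by
    have := hcell z
    simp only [cellOf, List.length_cons, List.length_append, List.length_map] at this ⊢
    simp at this ⊢
    omega
  have hst : ∀ e, StableFrom (Sat I.model I.formula) e N := fun e => by
    have := stableFrom_sat I.bounded I.formula e
    exact_mod_cast this
  have h1 : Ex prepare { inp := I.encode } (400 * l ^ 3) none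
      (stage (intWord I.position.1 ++ intWord I.position.2)
        (List.replicate (2 * N + 1) .sep) (formulaWord I.formula).reverse (grid N I.cellWord)) := by
    have := ex_prepare (n := I.n) (k := s) (l := l) (w := I.cellWord) (F := formulaWord I.formula)
      (B := I.n.bits.map Sym.bit) (rest := intWord I.position.1 ++ intWord I.position.2)
      (fun _ => mem_formulaWord) rfl
      (fun s hs => by
        obtain ⟨b, _, rfl⟩ := List.mem_map.1 hs
        simp)
      (by simp only [natWord, List.length_append] at hlen; omega)
      (fun z _ => I.cellWord_of_not_inBox)
      (fun z hz => by have := I.length_cellWord_le hz; omega)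
      (fun z _ s => I.mem_cellWord) hNl
    rw [← gridWord_eq] at this
    simpa [encode, natWord] using this
  have h2 := steps_eval (inp := intWord I.position.1 ++ intWord I.position.2)
    (cnt := List.replicate (2 * N + 1) .sep) (ns := I.names) I.bounded
    (fun z _ => I.atom_mem_names z) (fun z _ => I.here_mem_names z) hNl I.formula [] (fun _ => [])
    le_rfl (fun z _ => hcell z)
  rw [List.append_nil, ← hs] at h2
  have h3 := ex_readCoord (d := .right) (e := .left) (ns := I.names) (hst .right) (hst .left)
    I.position.1 (intWord I.position.2) hNl hcell' (by omega)
  have hv : (if I.position.1 < 0 then Dir.left else Dir.right).vert = false := by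
    split_ifs <;> rfl
  have h4 := ex_readCoord (d := .up) (e := .down) (ns := I.names)
    ((hst .up).shift (d := if I.position.1 < 0 then Dir.left else Dir.right)
      (by rw [hv]; simp [Dir.vert]) I.position.1.natAbs)
    ((hst .down).shift (d := if I.position.1 < 0 then Dir.left else Dir.right)
      (by rw [hv]; simp [Dir.vert]) I.position.1.natAbs)
    I.position.2 [] hNl hcell' (by omega)
  have h5 := ex_middle (ns := I.names) (fun z => decide (Sat I.model I.formula
    ((if I.position.1 < 0 then Dir.left else Dir.right).move^[I.position.1.natAbs]
      ((if I.position.2 < 0 then Dir.down else Dir.up).move^[I.position.2.natAbs] z)))) hNl hcell'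
  have hans : decide (Sat I.model I.formula
    ((if I.position.1 < 0 then Dir.left else Dir.right).move^[I.position.1.natAbs]
      ((if I.position.2 < 0 then Dir.down else Dir.up).move^[I.position.2.natAbs] (0, 0)))) =
      I.answer := by
    rw [answer, decide_eq_decide, move_iterate_fst, move_iterate_snd]
    simp
  rw [hans] at h5
  rw [List.append_nil] at h4
  rw [show I.cellWord = fun z => cellOf [] (I.names z) from funext I.cellWord_eq] at h1
  refine Ex.bind h1 (Ex.bind (h2.run (Ex.scan_nil rfl)) (Ex.bind h3 (Ex.bind h4 h5 le_rfl)
    le_rfl) le_rfl) ?_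
  have c1 : s * (140 * l ^ 3) ≤ 140 * l ^ 4 :=
    (Nat.mul_le_mul_right _ (by omega : s ≤ l)).trans_eq (by ring)
  have c2 : l ^ 3 ≤ l ^ 4 := Nat.pow_le_pow_right (by omega) (by norm_num)
  have c3 : l ≤ l ^ 4 := Nat.le_self_pow (by norm_num) l
  omega

end Instance

end CompassLogic

theorem mainTheorem7 (Atm : Type) [Encodable Atm] (m : ℕ) :
    Nonempty (Turing.TM2ComputableInPolyTime
      (CompassLogic.Instance.encode (Atm := Atm) (m := m)) Computability.encodeBool
      (CompassLogic.Instance.answer (Atm := Atm) (m := m))) := by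
  open Polynomial in
  refine CompassLogic.Cmd.computable CompassLogic.modelCheck .inp _ _ (1100 * (2 * X + 1) ^ 4)
    fun I => ?_
  have h : Function.update (fun _ => []) CompassLogic.Stk.inp I.encode =
      CompassLogic.Store.get { inp := I.encode } := by
    funext k
    cases k <;> rfl
  have h' : (fun _ => []) = CompassLogic.Store.get {} := by
    funext k
    cases k <;> rfl
  rw [h, h']
  simpa [CompassLogic.Ex] using I.ex_modelCheck
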